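/- **Theorem (power of the rank-transformed subsampling test under locally uniform convergence of the copula).** *Setting.* Let $\mathcal P$ be a set of probability measures on a space $\mathcal X$ and $\mathcal P_0\subseteq\mathcal P$ the null hypothesis. For each $n$ let $T_n^{(1)},\dots,T_n^{(L)}$ ($L\ge 1$) be real statistics, measurable functions of a sample $X=(X_1,\dots,X_n)$ and of external randomness $\Omega$ with law $P_\Omega$, and suppose that for every $P\in\mathcal P$ and every $n$ the vector $(T_n^{(1)},\dots,T_n^{(L)})$ is exchangeable under $(X,\Omega)\sim P^n\times P_\Omega$. Let $F_{n,P}$ be the distribution function of $T_n^{(1)}$ under $P^n\times P_\Omega$. Let $F_0$ be the distribution function of $\mathrm{unif}(0,1)$ or of $\mathcal N(0,1)$, and suppose that $T_n^{(1)}\to_d F_0$ under $P^n\times P_\Omega$ for every $P\in\mathcal P_0$. Let $S:\mathbb R^L\to\mathbb R$ be $1$-Lipschitz for $\|\cdot\|_\infty$ and $S_n:=S(T_n^{(1)},\dots,T_n^{(L)})$. Suppose that for every $P\in\mathcal P_0$, $S_n\to_d G_P$ under $P^n\times P_\Omega$, where $G_P$ has a bounded Lebesgue density. For a distribution function $F$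 write $F^{-1}(p)=\inf\{x:F(x)\ge p\}$. *The test.* Fix an integer $J\ge 1$ and subsample sizes $m=m_n$ with $m_n\to\infty$ and $m_n/n\to0$ (for instance $m_n=\lfloor n/\log n\rfloor$), and let $B=J\lfloor n/m\rfloor$. Draw $J$ independent uniformly random permutations of $\{1,\dots,n\}$ and cut each into its first $\lfloor n/m\rfloor$ consecutive blocks of length $m$; this gives $B$ subsamples. Compute $(T_m^{(1)},\dots,T_m^{(L)})$ on each subsample, with fresh independent external randomness from $P_\Omega$ for each one; this gives a $B\times L$ matrix $(\hat H_{b,l})$ whose entries have empirical distribution function $\mathbb F_{\hat{\mathbf H}}$. Let $\tilde H_{b,l}=F_0^{-1}\big(\mathbb F_{\hat{\mathbf H}}(\hat H_{b,l})-\tfrac1{2BL}\big)$, $\tilde S_b=S(\tilde H_{b,1},\dots,\tilde H_{b,L})$, and let $\tilde G_n$ be the empirical distribution function of $\tilde S_1,\dots,\tilde S_B$. The test of level $\alpha$ rejects when $S_n>\tilde G_n^{-1}(1-\alpha)$. *Assumption at $P_0$.* Fix $P_0\in\mathcal P_0$, and suppose there is a random vector $(C^{(1)},\dots,C^{(L)})$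 such that for every sequence $P_n\in\mathcal P$ with $P_n\to_d P_0$, $$\big(F_{n,P_n}(T_n^{(1)}),\dots,F_{n,P_n}(T_n^{(L)})\big)\to_d (C^{(1)},\dots,C^{(L)})\quad\text{under }(X,\Omega)\sim P_n^n\times P_\Omega .$$ *Conclusion.* For every sequence $P_n\in\mathcal P$ with $P_n\to_d P_0$, under $(X,\Omega)\sim P_n^n\times P_\Omega$: 1. for every $\alpha\in(0,1)$ such that the quantile function $G_{P_0}^{-1}$ is continuous at $1-\alpha$ (that is, for all but at most countably many $\alpha$), $$\tilde G_n^{-1}(1-\alpha)\to_p G_{P_0}^{-1}(1-\alpha);$$ 2. let $\beta_n(\alpha)=\mathbb P_{P_n}\{S_n>\tilde G_n^{-1}(1-\alpha)\}$ be the power of the test and $\beta_n^{\mathrm{or}}(\alpha)=\mathbb P_{P_n}\{S_n>G_{P_0}^{-1}(1-\alpha)\}$ that of the oracle test. Then $\int_0^1|\beta_n(\alpha)-\beta_n^{\mathrm{or}}(\alpha)|\,d\alpha\to0$; and if $S_n$ converges in distribution to some law under $P_n^n\times P_\Omega$, then $\beta_n(\alpha)-\beta_n^{\mathrm{or}}(\alpha)\to0$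 for Lebesgue-almost every $\alpha\in(0,1)$. -/

import Mathlib

open MeasureTheory ProbabilityTheory Filter Topology
open scoped ENNReal NNReal

namespace RankSub

/-! ### Distribution functions -/

/-- The (left-continuous) quantile function `F⁻¹(p) = inf {x : F x ≥ p}`. -/
noncomputable def quantile (F : ℝ → ℝ) (p : ℝ) : ℝ := sInf {x : ℝ | p ≤ F x}

/-- The empirical distribution function of a finite family of real numbers. -/
noncomputable def empCDF {ι : Type*} [Fintype ι] (x : ι → ℝ) (t : ℝ) : ℝ :=
  (Nat.card {i : ι // x i ≤ t} : ℝ) / (Fintype.card ι : ℝ)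

/-- `G` has a density with respect to Lebesgue measure that is bounded on the whole line
(in particular, `G` has a continuous distribution function). -/
def HasBoundedDensity (G : Measure ℝ) : Prop :=
  ∃ g : ℝ → ℝ≥0, Measurable g ∧ (∃ M : ℝ≥0, ∀ x, g x ≤ M) ∧
    G = volume.withDensity (fun x => (g x : ℝ≥0∞))

/-! ### The sampling model and the single-split statistics -/

section Model

variable {𝒳 𝒲 : Type*} [MeasurableSpace 𝒳] [MeasurableSpace 𝒲] {L : ℕ}

/-- The law `P ^ n × P_Ω` of `(X, Ω)`: an i.i.d. sample of size `n` from `P` together with the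
independent external randomness of the analyst. -/
noncomputable def sampleLaw (PΩ : Measure 𝒲) (P : ProbabilityMeasure 𝒳) (n : ℕ) :
    Measure ((Fin n → 𝒳) × 𝒲) :=
  (Measure.pi (fun _ : Fin n => (P : Measure 𝒳))).prod PΩ

instance (PΩ : Measure 𝒲) [IsProbabilityMeasure PΩ] (P : ProbabilityMeasure 𝒳) (n : ℕ) :
    IsProbabilityMeasure (sampleLaw PΩ P n) := by
  unfold sampleLaw; infer_instance

/-- `(T_n^{(1)}, …, T_n^{(L)})` is exchangeable under `(X, Ω) ∼ P ^ n × P_Ω`, for every `n`. -/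
def IsExchangeable (PΩ : Measure 𝒲) (T : (n : ℕ) → (Fin n → 𝒳) × 𝒲 → Fin L → ℝ)
    (P : ProbabilityMeasure 𝒳) : Prop :=
  ∀ (n : ℕ) (σ : Equiv.Perm (Fin L)),
    (sampleLaw PΩ P n).map (fun z l => T n z (σ l)) = (sampleLaw PΩ P n).map (T n)

/-- The distribution function `F_{n,P}` of `T_n^{(1)}` under `(X, Ω) ∼ P ^ n × P_Ω`. -/
noncomputable def singleCDF [NeZero L] (PΩ : Measure 𝒲)
    (T : (n : ℕ) → (Fin n → 𝒳) × 𝒲 → Fin L → ℝ) (P : ProbabilityMeasure 𝒳) (n : ℕ) (x : ℝ) : ℝ :=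
  cdf ((sampleLaw PΩ P n).map (fun z => T n z 0)) x

/-- The copula vector `(F_{n,P}(T_n^{(1)}), …, F_{n,P}(T_n^{(L)}))`. -/
noncomputable def copulaVec [NeZero L] (PΩ : Measure 𝒲)
    (T : (n : ℕ) → (Fin n → 𝒳) × 𝒲 → Fin L → ℝ) (P : ProbabilityMeasure 𝒳) (n : ℕ)
    (z : (Fin n → 𝒳) × 𝒲) : Fin L → ℝ :=
  fun l => singleCDF PΩ T P n (T n z l)

end Model

/-! ### Rank-transformed subsampling -/

theorem block_lt {n m : ℕ} (k : Fin (n / m)) (i : Fin m) : (k : ℕ) * m + i < n :=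
  calc (k : ℕ) * m + i < (k : ℕ) * m + m := Nat.add_lt_add_left i.2 _
    _ = ((k : ℕ) + 1) * m := (Nat.succ_mul _ _).symm
    _ ≤ (n / m) * m := Nat.mul_le_mul_right m k.2
    _ ≤ n := Nat.div_mul_le_self n m

/-- The `k`-th of the `⌊n/m⌋` disjoint consecutive blocks of length `m` of the permuted indices:
`(π_{km+1}, …, π_{km+m})` (with `k` counted from `0`). -/
def block {n m : ℕ} (π : Equiv.Perm (Fin n)) (k : Fin (n / m)) (i : Fin m) : Fin n :=
  π ⟨(k : ℕ) * m + i, block_lt k i⟩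

/-- The `B = J ⌊n/m⌋` subsamples are indexed by a permutation number and a block number. -/
abbrev SubIdx (n m J : ℕ) : Type := Fin J × Fin (n / m)

instance (n : ℕ) : MeasurableSpace (Equiv.Perm (Fin n)) := ⊤

/-- Everything the procedure draws at sample size `n`: the data and the external randomness of the
full-sample statistics; `J` permutations of the indices; and the external randomness that is
regenerated for each of the `B = J ⌊n/m⌋` subsamples. -/
abbrev Draw (𝒳 𝒲 : Type*) (n m J : ℕ) : Type _ :=
  ((Fin n → 𝒳) × 𝒲) × ((Fin J → Equiv.Perm (Fin n)) × (SubIdx n m J → 𝒲))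

section Procedure

variable {𝒳 𝒲 : Type*} {L : ℕ}

/-- The joint law of the draws: `(X, Ω) ∼ P ^ n × P_Ω`, the permutations are i.i.d. uniform, the
regenerated external randomness is i.i.d. from `P_Ω`, and all of these are independent. -/
noncomputable def drawLaw [MeasurableSpace 𝒳] [MeasurableSpace 𝒲] (PΩ : Measure 𝒲)
    (P : ProbabilityMeasure 𝒳) (n m J : ℕ) : Measure (Draw 𝒳 𝒲 n m J) :=
  (sampleLaw PΩ P n).prod
    ((Measure.pi (fun _ : Fin J => (PMF.uniformOfFintype (Equiv.Perm (Fin n))).toMeasure)).prod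
      (Measure.pi (fun _ : SubIdx n m J => PΩ)))

/-- The `B × L` matrix `Ĥ` whose rows are the statistics `(T_m^{(1)}, …, T_m^{(L)})` computed on
the subsamples. -/
def subStats (T : (n : ℕ) → (Fin n → 𝒳) × 𝒲 → Fin L → ℝ) {n m J : ℕ} (d : Draw 𝒳 𝒲 n m J) :
    SubIdx n m J → Fin L → ℝ :=
  fun b => T m (fun i => d.1.1 (block (d.2.1 b.1) b.2 i), d.2.2 b)

/-- The rank transform of a matrix with `B` rows and `L` columns: each entry is replaced by
`F₀⁻¹(𝔽(entry) - 1 / (2 B L))`, where `𝔽` is the empirical distribution function of all entries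
(so that `B L 𝔽(entry)` is the rank of the entry). -/
noncomputable def rankTransform (F₀ : ℝ → ℝ) {ι : Type*} [Fintype ι] (H : ι → Fin L → ℝ) :
    ι → Fin L → ℝ :=
  fun b l => quantile F₀
    (empCDF (fun q : ι × Fin L => H q.1 q.2) (H b l) - 1 / (2 * (Fintype.card ι : ℝ) * (L : ℝ)))

/-- The rank-transformed subsampling distribution function `G̃_n`: the empirical distribution
function of the aggregated rows of the rank-transformed matrix. -/
noncomputable def rankSubCDF (F₀ : ℝ → ℝ) (S : (Fin L → ℝ) → ℝ)
    (T : (n : ℕ) → (Fin n → 𝒳) × 𝒲 → Fin L → ℝ) {n m J : ℕ} (d : Draw 𝒳 𝒲 n m J) : ℝ → ℝ :=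
  empCDF (fun b => S (rankTransform F₀ (subStats T d) b))

/-- The critical value `G̃_n⁻¹(1 - α)` of the aggregated multiple-split test. -/
noncomputable def critValue (F₀ : ℝ → ℝ) (S : (Fin L → ℝ) → ℝ)
    (T : (n : ℕ) → (Fin n → 𝒳) × 𝒲 → Fin L → ℝ) (α : ℝ) {n m J : ℕ} (d : Draw 𝒳 𝒲 n m J) : ℝ :=
  quantile (rankSubCDF F₀ S T d) (1 - α)

/-- The probability, under `P`, that the aggregated multiple-split test at sample size `n` rejects,
that is, `S_n > G̃_n⁻¹(1 - α)`. -/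
noncomputable def testPower [MeasurableSpace 𝒳] [MeasurableSpace 𝒲] (PΩ : Measure 𝒲)
    (F₀ : ℝ → ℝ) (S : (Fin L → ℝ) → ℝ) (T : (n : ℕ) → (Fin n → 𝒳) × 𝒲 → Fin L → ℝ)
    (P : ProbabilityMeasure 𝒳) (n m J : ℕ) (α : ℝ) : ℝ :=
  (drawLaw PΩ P n m J).real {d | critValue F₀ S T α d < S (T n d.1)}

/-- The probability, under `P`, that the oracle test at sample size `n` rejects, that is,
`S_n > G⁻¹(1 - α)`, where `G` is the given distribution. -/
noncomputable def oraclePower [MeasurableSpace 𝒳] [MeasurableSpace 𝒲] (PΩ : Measure 𝒲)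
    (G : Measure ℝ) (S : (Fin L → ℝ) → ℝ) (T : (n : ℕ) → (Fin n → 𝒳) × 𝒲 → Fin L → ℝ)
    (P : ProbabilityMeasure 𝒳) (n : ℕ) (α : ℝ) : ℝ :=
  (sampleLaw PΩ P n).real {z | quantile (cdf G) (1 - α) < S (T n z)}

end Procedure

end RankSub

/-! The argument rests on the copula being invariant under increasing transformations of the
statistics. Under a local alternative the marginal law of the statistics is unknown and need not
converge, but normalized ranks estimate `F_{m,P_n}(T_m)` without knowledge of `F_{m,P_n}`. Mapping
them through `F₀⁻¹` therefore rebuilds the null marginals around a copula that is asymptotically the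
null one.

The limit law is identified at `P₀`. There `F_{n,P₀} → F₀` uniformly, so the marginals of `C` are
uniform and `S(T_n) ≈ S(F₀⁻¹(F_{n,P₀}(T_n)))`; hence `S(F₀⁻¹(C))` has law `G_{P₀}`. Since `F₀⁻¹` may
be unbounded, coordinates are cut off to `[δ, 1 - δ]`. The error is at most the expected number of
coordinates near 0 or 1, of order `Lδ` (`abs_integral_sub_integral_truncAgg_le`).

Along `P_n`, the assumption on all sequences also gives the copula limit at sample size `m_n`
(`tendsto_of_forall_seq`). The blocks of one permutation are disjoint, hence i.i.d., and their
number tends to infinity, so Chebyshev's inequality and a union bound over the `J` permutations give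
a law of large numbers (`tendsto_rowMean`). Applied to the pooled copula transforms, it makes them
nearly uniform, so that ranks and copula transforms agree uniformly over the entries
(`abs_empCDF_sub_le`). Applied to the truncated aggregation, it gives the limit of the
rank-transformed averages (`tendsto_rowMean_rankTransform`). Ramp test functions and a finite grid
turn this into `sup |G̃_n - G_{P₀}| → 0` in probability, since `G_{P₀}` has no atoms.

For the power, if `G̃_n` is within `η` of `G_{P₀}`, its quantile at `p` lies between those of
`G_{P₀}` at `p - η` and `p + η` (if these levels lie in `(0, 1)`). The power is thus sandwiched
between oracle powers at shifted levels, whatever the dependence between `S_n` and the subsamples.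
The increments of the oracle power, monotone in the level, integrate to at most `2η`. If `S_n` has a
limit law, only the countably many levels where the quantile function is discontinuous or hits an
atom of that law are excluded. -/

namespace RankSub

/-! ### Events of asymptotic probability one -/

section WithHighProbability

variable {Ω : ℕ → Type*} [∀ n, MeasurableSpace (Ω n)]

/-- The filter of events, along a sequence of spaces, whose complements have measure tending
to zero. Convergence along this filter is convergence in probability. -/
def whp (μ : ∀ n, Measure (Ω n)) : Filter (Σ n, Ω n) where
  sets := {s | Tendsto (fun n => μ n {ω | (⟨n, ω⟩ : Σ n, Ω n) ∉ s}) atTop (𝓝 0)}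
  univ_sets := by simp
  sets_of_superset {s t} hs hst := by
    refine tendsto_of_tendsto_of_tendsto_of_le_of_le tendsto_const_nhds hs
      (fun _ => zero_le) fun n => measure_mono fun ω hω h => hω (hst h)
  inter_sets {s t} hs ht := by
    have h := Tendsto.add hs ht
    rw [add_zero] at h
    refine tendsto_of_tendsto_of_tendsto_of_le_of_le tendsto_const_nhds h
      (fun _ => zero_le) fun n => ?_
    refine (measure_mono ?_).trans (measure_union_le _ _)
    intro ω hω
    by_contra hc
    simp only [Set.mem_union, Set.mem_ofPred_eq, not_or, not_not] at hc
    exact hω ⟨hc.1, hc.2⟩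

/-- The events need not be measurable: the filter axioms use only monotonicity and subadditivity,
which hold for the outer measure. Conditions over all real `t` can thus be used directly. -/
theorem eventually_whp {μ : ∀ n, Measure (Ω n)} {p : (Σ n, Ω n) → Prop} :
    (∀ᶠ x in whp μ, p x) ↔ Tendsto (fun n => μ n {ω | ¬ p ⟨n, ω⟩}) atTop (𝓝 0) := Iff.rfl

theorem eventually_whp_of_eventually {μ : ∀ n, Measure (Ω n)} {p : ℕ → Prop}
    (h : ∀ᶠ n in atTop, p n) : ∀ᶠ x in whp μ, p x.1 := by
  rw [eventually_whp]
  refine tendsto_const_nhds.congr' ?_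
  filter_upwards [h] with n hn
  simp [hn]

end WithHighProbability

/-! ### Uniform closeness of distribution functions -/

/-- Pointwise closeness of a monotone function to a distribution function without jumps, at a
suitable finite set of points, implies uniform closeness. -/
theorem exists_finset_forall_abs_sub_le {F : ℝ → ℝ} (hF : Monotone F)
    (h01 : ∀ x, F x ∈ Set.Icc (0 : ℝ) 1) (hsurj : ∀ v ∈ Set.Ioo (0 : ℝ) 1, ∃ x, F x = v)
    {ε : ℝ} (hε : 0 < ε) :
    ∃ A : Finset ℝ, (∀ a ∈ A, F a ∈ Set.Ioo (0 : ℝ) 1) ∧ ∀ H : ℝ → ℝ, Monotone H →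
      (∀ x, H x ∈ Set.Icc (0 : ℝ) 1) →
      ∀ η, 0 ≤ η → (∀ a ∈ A, |H a - F a| ≤ η) → ∀ x, |H x - F x| ≤ ε + η := by
  classical
  -- The grid consists of points where `F` takes the values `k / K` for `0 < k < K`, with mesh below
  -- `ε`.
  obtain ⟨K, hK⟩ := exists_nat_gt (1 / ε)
  have hK0 : (0 : ℝ) < K := lt_trans (by positivity) hK
  have hKε : 1 / (K : ℝ) < ε := by
    rw [div_lt_iff₀ hε] at hK
    rw [div_lt_iff₀ hK0]; linarith
  have hv : ∀ k ∈ Finset.Ioo 0 K, ((k : ℝ) / K) ∈ Set.Ioo (0 : ℝ) 1 := by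
    intro k hk
    rw [Finset.mem_Ioo] at hk
    have h1 : (0 : ℝ) < k := by exact_mod_cast hk.1
    have h2 : (k : ℝ) < K := by exact_mod_cast hk.2
    exact ⟨by positivity, by rw [div_lt_one hK0]; exact h2⟩
  choose! X hX using hsurj
  refine ⟨(Finset.Ioo 0 K).image (fun k : ℕ => X (k / K)), ?_, ?_⟩
  · intro a ha
    obtain ⟨k, hk, rfl⟩ := Finset.mem_image.1 ha
    rw [hX _ (hv k hk)]; exact hv k hk
  intro H hH hH01 η hη hA x
  have hA' : ∀ k ∈ Finset.Ioo 0 K, |H (X (k / K)) - k / K| ≤ η := fun k hk => by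
    have := hA _ (Finset.mem_image_of_mem _ hk)
    rwa [hX _ (hv k hk)] at this
  have hx := h01 x
  rw [abs_le]
  constructor
  · by_contra! hc
    have hpos : 0 < F x := by linarith [(hH01 x).1]
    -- The largest index with `k / K < F x`, so its grid point lies to the left of `x`. The case `k
    -- = 0` has no grid point and is excluded by `0 ≤ H x`.
    set k := ⌈K * F x⌉₊ - 1 with hk
    have hc1 : 0 < ⌈K * F x⌉₊ := Nat.ceil_pos.2 (by positivity)
    have hk1 : (k : ℝ) + 1 = ⌈K * F x⌉₊ := by
      rw [hk, Nat.cast_sub hc1]; push_cast; ring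
    have hlt : (k : ℝ) < K * F x := by
      have := Nat.ceil_lt_add_one (a := K * F x) (by positivity); linarith
    have hge : K * F x ≤ k + 1 := by rw [hk1]; exact Nat.le_ceil _
    have hge' : F x ≤ k / K + 1 / K := by
      rw [← add_div, le_div_iff₀ hK0]; linarith
    have hkpos : 0 < k := by
      rcases Nat.eq_zero_or_pos k with h0 | h0
      · rw [h0] at hge'; simp only [Nat.cast_zero, zero_div] at hge'
        linarith [(hH01 x).1]
      · exact h0
    have hkK : k < K := by
      have : (k : ℝ) < K := lt_of_lt_of_le hlt (by nlinarith [hx.2])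
      exact_mod_cast this
    have hmem := Finset.mem_Ioo.2 ⟨hkpos, hkK⟩
    have hxx : X (k / K) ≤ x := by
      by_contra! h
      have := hF h.le
      rw [hX _ (hv k hmem), le_div_iff₀ hK0] at this
      linarith
    have := hH hxx
    have h3 := (abs_le.1 (hA' k hmem)).1
    linarith
  · by_contra! hc
    -- The smallest index with `F x < k / K`, so its grid point lies to the right of `x`; `k ≥ K` is
    -- excluded by `H x ≤ 1`.
    set k := ⌊K * F x⌋₊ + 1 with hk
    have h0 : 0 ≤ K * F x := mul_nonneg hK0.le hx.1
    have hlt : K * F x < k := by rw [hk]; push_cast; exact Nat.lt_floor_add_one _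
    have hle : (k : ℝ) ≤ K * F x + 1 := by
      rw [hk]; push_cast; linarith [Nat.floor_le h0]
    have hle' : (k : ℝ) / K ≤ F x + 1 / K := by
      rw [div_le_iff₀ hK0, add_mul, one_div_mul_cancel hK0.ne']; linarith
    have hkK : k < K := by
      by_contra! h
      have : (K : ℝ) ≤ k := by exact_mod_cast h
      have h1 : 1 ≤ (k : ℝ) / K := by rwa [one_le_div hK0]
      linarith [(hH01 x).2]
    have hmem := Finset.mem_Ioo.2 ⟨Nat.succ_pos _, hkK⟩
    have hxx : x ≤ X (k / K) := by
      by_contra! h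
      have := hF h.le
      rw [hX _ (hv k hmem), div_le_iff₀ hK0] at this
      linarith
    have := hH hxx
    have h3 := (abs_le.1 (hA' k hmem)).2
    linarith

/-- The distribution function of the uniform distribution on `[0, 1]`. -/
def clampUnit (u : ℝ) : ℝ := max 0 (min 1 u)

theorem monotone_clampUnit : Monotone clampUnit := fun _ _ h =>
  max_le_max le_rfl (min_le_min le_rfl h)

theorem clampUnit_mem_Icc (u : ℝ) : clampUnit u ∈ Set.Icc (0 : ℝ) 1 :=
  ⟨le_max_left _ _, max_le zero_le_one (min_le_left _ _)⟩

theorem clampUnit_of_mem {u : ℝ} (hu : u ∈ Set.Icc (0 : ℝ) 1) : clampUnit u = u := by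
  rw [clampUnit, min_eq_right hu.2, max_eq_right hu.1]

theorem mem_Ioo_of_clampUnit_mem {u : ℝ} (hu : clampUnit u ∈ Set.Ioo (0 : ℝ) 1) :
    u ∈ Set.Ioo (0 : ℝ) 1 := by
  unfold clampUnit at hu
  obtain ⟨h0, h1⟩ := hu
  constructor
  · rcases lt_max_iff.1 h0 with h | h
    · exact absurd h (lt_irrefl _)
    · exact (lt_min_iff.1 h).2
  · rcases min_lt_iff.1 (max_lt_iff.1 h1).2 with h | h
    · exact absurd h (lt_irrefl _)
    · exact h

theorem exists_clampUnit_eq : ∀ v ∈ Set.Ioo (0 : ℝ) 1, ∃ x, clampUnit x = v :=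
  fun v hv => ⟨v, clampUnit_of_mem ⟨hv.1.le, hv.2.le⟩⟩

theorem continuous_cdf (μ : Measure ℝ) [IsProbabilityMeasure μ] [NullSingletonClass μ] :
    Continuous (cdf μ) := by
  rw [continuous_iff_continuousAt]
  intro x
  rw [(cdf μ).mono.continuousAt_iff_leftLim_eq_rightLim, (cdf μ).rightLim_eq]
  have h := (cdf μ).measure_singleton x
  rw [measure_cdf, measure_singleton] at h
  have h2 := ENNReal.ofReal_eq_zero.1 h.symm
  exact le_antisymm ((cdf μ).mono.leftLim_le le_rfl) (by linarith)

/-- A distribution function without jumps takes all values in `(0, 1)`. -/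
theorem exists_cdf_eq (μ : Measure ℝ) [IsProbabilityMeasure μ] [NullSingletonClass μ] :
    ∀ v ∈ Set.Ioo (0 : ℝ) 1, ∃ x, cdf μ x = v := by
  intro v hv
  exact mem_range_of_exists_le_of_exists_ge (continuous_cdf μ)
    ((((tendsto_cdf_atBot μ).eventually (gt_mem_nhds hv.1)).exists).imp fun _ h => h.le)
    ((((tendsto_cdf_atTop μ).eventually (lt_mem_nhds hv.2)).exists).imp fun _ h => h.le)

theorem cdf_mem_Icc (μ : Measure ℝ) (x : ℝ) : cdf μ x ∈ Set.Icc (0 : ℝ) 1 :=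
  ⟨cdf_nonneg μ x, cdf_le_one μ x⟩

/-! ### Quantile functions -/

/-- The side conditions keep the default value 0 of `sInf` on empty or unbounded sets out of play;
for distribution functions they hold at levels in `(0, 1)`. -/
theorem quantile_mono {F H : ℝ → ℝ} {p q : ℝ} (h : ∀ x, q ≤ H x → p ≤ F x)
    (hb : ∃ x₀, ∀ x, p ≤ F x → x₀ ≤ x) (hne : ∃ x, q ≤ H x) : quantile F p ≤ quantile H q :=
  csInf_le_csInf (hb.imp fun _ h _ hx => h _ hx) hne fun x hx => h x hx

theorem quantile_le {F : ℝ → ℝ} {p x : ℝ} (hb : ∃ x₀, ∀ x, p ≤ F x → x₀ ≤ x) (h : p ≤ F x) :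
    quantile F p ≤ x :=
  csInf_le (hb.imp fun _ h _ hx => h _ hx) h

theorem le_quantile {F : ℝ → ℝ} (hF : Monotone F) {p x : ℝ} (hne : ∃ x, p ≤ F x) (h : F x < p) :
    x ≤ quantile F p :=
  le_csInf hne fun y hy => by
    by_contra! hc
    exact absurd (hF hc.le) (not_le.2 (h.trans_le hy))

theorem bddBelow_of_lt {F : ℝ → ℝ} (hF : Monotone F) {p : ℝ} (h : ∃ x, F x < p) :
    ∃ x₀, ∀ x, p ≤ F x → x₀ ≤ x := by
  obtain ⟨x₀, h₀⟩ := h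
  exact ⟨x₀, fun x hx => by
    by_contra! hc
    exact absurd (hF hc.le) (not_le.2 (h₀.trans_le hx))⟩

theorem exists_cdf_lt (μ : Measure ℝ) {p : ℝ} (hp : 0 < p) : ∃ x, cdf μ x < p :=
  ((tendsto_cdf_atBot μ).eventually (gt_mem_nhds hp)).exists

theorem exists_le_cdf (μ : Measure ℝ) {p : ℝ} (hp : p < 1) : ∃ x, p ≤ cdf μ x :=
  (((tendsto_cdf_atTop μ).eventually (lt_mem_nhds hp)).exists).imp fun _ h => h.le

theorem quantile_cdf_le (μ : Measure ℝ) {p x : ℝ} (hp : 0 < p) (h : p ≤ cdf μ x) :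
    quantile (cdf μ) p ≤ x :=
  quantile_le (bddBelow_of_lt (monotone_cdf μ) (exists_cdf_lt μ hp)) h

theorem le_quantile_cdf (μ : Measure ℝ) {p x : ℝ} (hp : p < 1) (h : cdf μ x < p) :
    x ≤ quantile (cdf μ) p :=
  le_quantile (monotone_cdf μ) (exists_le_cdf μ hp) h

theorem monotoneOn_quantile_cdf (μ : Measure ℝ) :
    MonotoneOn (quantile (cdf μ)) (Set.Ioo 0 1) := fun _ hp _ hq h =>
  quantile_mono (fun _ hx => h.trans hx)
    (bddBelow_of_lt (monotone_cdf μ) (exists_cdf_lt μ hp.1)) (exists_le_cdf μ hq.2)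

theorem strictMonoOn_quantile_cdf (μ : Measure ℝ) [IsProbabilityMeasure μ] [NullSingletonClass μ] :
    StrictMonoOn (quantile (cdf μ)) (Set.Ioo 0 1) := by
  intro p hp q hq hpq
  obtain ⟨v, hpv, hvq⟩ := exists_between hpq
  obtain ⟨w, hvw, hwq⟩ := exists_between hvq
  obtain ⟨x, hx⟩ := exists_cdf_eq μ v ⟨hp.1.trans hpv, hvq.trans hq.2⟩
  obtain ⟨y, hy⟩ := exists_cdf_eq μ w ⟨hp.1.trans (hpv.trans hvw), hwq.trans hq.2⟩
  have hxy : x < y := by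
    by_contra! h
    have := monotone_cdf μ h
    linarith
  calc quantile (cdf μ) p ≤ x := quantile_cdf_le μ hp.1 (by linarith)
    _ < y := hxy
    _ ≤ _ := le_quantile_cdf μ hq.2 (by linarith)

/-- The regularity of a distribution function that the rank transform needs: no jumps, and
strictly increasing wherever it lies in `(0, 1)`. -/
structure IsRegular (F : ℝ → ℝ) : Prop where
  mono : Monotone F
  mem_Icc : ∀ x, F x ∈ Set.Icc (0 : ℝ) 1
  surj : ∀ v ∈ Set.Ioo (0 : ℝ) 1, ∃ x, F x = v
  strict : ∀ x y, F x ∈ Set.Ioo (0 : ℝ) 1 → x < y → F x < F y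

/-- Strictness amounts to `(x, y]` having positive mass. In the uniform case `0 < F x < 1` forces `0
≤ x < 1`, so `(x, min y 1]` has positive length; in the Gaussian case Lebesgue measure is absolutely
continuous with respect to the law. -/
theorem isRegular_cdf (μ : Measure ℝ) [IsProbabilityMeasure μ]
    (hμ : μ = volume.restrict (Set.Icc 0 1) ∨ μ = gaussianReal 0 1) : IsRegular (cdf μ) := by
  have hna : NullSingletonClass μ := by
    rcases hμ with h | h
    · rw [h]; infer_instance
    · rw [h]; exact nullSingletonClass_gaussianReal one_ne_zero
  refine ⟨monotone_cdf μ, cdf_mem_Icc μ, exists_cdf_eq μ, fun x y hx hxy => ?_⟩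
  have hdiff : cdf μ y - cdf μ x = μ.real (Set.Ioc x y) := by
    rw [cdf_eq_real, cdf_eq_real, ← Set.Iic_sdiff_Iic,
      measureReal_sdiff (Set.Iic_subset_Iic.2 hxy.le) measurableSet_Iic]
  suffices h : μ (Set.Ioc x y) ≠ 0 by
    have : 0 < μ.real (Set.Ioc x y) := ENNReal.toReal_pos h (measure_ne_top _ _)
    linarith
  rcases hμ with h | h
  · have h0 : 0 ≤ x := by
      by_contra! hc
      have : μ (Set.Iic x) = 0 := by
        rw [h, Measure.restrict_apply measurableSet_Iic]
        convert! measure_empty (μ := (volume : Measure ℝ))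
        ext t; simp only [Set.mem_inter_iff, Set.mem_Iic, Set.mem_Icc, Set.mem_empty_iff_false,
          iff_false]
        intro ht; linarith [ht.1, ht.2.1]
      rw [cdf_eq_real, measureReal_def, this] at hx
      simp at hx
    have h1 : x < 1 := by
      by_contra! hc
      have h1 : μ (Set.Iic x)ᶜ = 0 := by
        rw [h, Measure.restrict_apply measurableSet_Iic.compl]
        convert! measure_empty (μ := (volume : Measure ℝ))
        ext t; simp only [Set.mem_inter_iff, Set.mem_compl_iff, Set.mem_Iic, Set.mem_Icc,
          Set.mem_empty_iff_false, iff_false]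
        intro ht; exact ht.1 (ht.2.2.trans hc)
      have h2 := (prob_compl_eq_zero_iff (μ := μ) (measurableSet_Iic (a := x))).1 h1
      rw [cdf_eq_real, measureReal_def, h2] at hx
      simp at hx
    rw [h, Measure.restrict_apply measurableSet_Ioc]
    refine ne_of_gt (lt_of_lt_of_le ?_ (measure_mono (s := Set.Ioc x (min y 1)) ?_))
    · rw [Real.volume_Ioc]
      exact ENNReal.ofReal_pos.2 (sub_pos.2 (lt_min hxy h1))
    · intro t ht
      exact ⟨⟨ht.1, ht.2.trans (min_le_left _ _)⟩, (h0.trans_lt ht.1).le,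
        ht.2.trans (min_le_right _ _)⟩
  · intro h0
    rw [h] at h0
    have := gaussianReal_absolutelyContinuous' 0 (v := 1) one_ne_zero h0
    rw [Real.volume_Ioc, ENNReal.ofReal_eq_zero] at this
    linarith

namespace IsRegular

variable {F : ℝ → ℝ}

theorem lt_apply (hF : IsRegular F) {x y v : ℝ} (hv : v ∈ Set.Ioo (0 : ℝ) 1) (h : F x = v)
    (hxy : x < y) : v < F y := h ▸ hF.strict x y (by rwa [h]) hxy

theorem apply_lt (hF : IsRegular F) {x y v : ℝ} (hv : v ∈ Set.Ioo (0 : ℝ) 1) (h : F y = v)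
    (hxy : x < y) : F x < v := by
  rcases (hF.mem_Icc x).1.eq_or_lt with h0 | h0
  · rw [← h0]; exact hv.1
  · have h1 : F x ≤ v := h ▸ hF.mono hxy.le
    rw [← h]; exact hF.strict x y ⟨h0, h1.trans_lt hv.2⟩ hxy

/-- Strict increase rules out a flat piece of `F` ending at `t`. This is what recovers the statistic
from its `F₀`-transform under the null. -/
theorem quantile_apply (hF : IsRegular F) {t : ℝ} (ht : F t ∈ Set.Ioo (0 : ℝ) 1) :
    quantile F (F t) = t := by
  have : {x : ℝ | F t ≤ F x} = Set.Ici t := by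
    ext x
    refine ⟨fun h => ?_, fun h => hF.mono h⟩
    by_contra! hc
    exact absurd (hF.apply_lt ht rfl (not_le.1 hc)) (not_lt.2 h)
  rw [quantile, this, csInf_Ici]

/-- By strict increase the values of `F` at `x ± ε / 2` lie strictly on either side of `u = F x`, so
all levels close to `u` have their quantile within `ε / 2` of `x`. -/
theorem continuousAt_quantile (hF : IsRegular F) {u : ℝ} (hu : u ∈ Set.Ioo (0 : ℝ) 1) :
    ContinuousAt (quantile F) u := by
  obtain ⟨x, rfl⟩ := hF.surj u hu
  rw [Metric.continuousAt_iff']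
  intro ε hε
  have h1 := hF.apply_lt hu rfl (x := x - ε / 2) (by linarith)
  have h2 := hF.lt_apply hu rfl (y := x + ε / 2) (by linarith)
  filter_upwards [lt_mem_nhds h1, gt_mem_nhds h2] with p hp1 hp2
  rw [hF.quantile_apply hu, Real.dist_eq, abs_lt]
  have h3 := quantile_le (bddBelow_of_lt hF.mono ⟨_, hp1⟩) hp2.le
  have h4 := le_quantile hF.mono ⟨_, hp2.le⟩ hp1
  constructor <;> linarith

/-- Cutting off the tails makes the quantile function uniformly continuous. -/
theorem uniformContinuous_quantile_clamp (hF : IsRegular F) {δ : ℝ} (hδ : 0 < δ)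
    (hδ' : δ ≤ 1 / 2) : UniformContinuous fun u => quantile F (max δ (min (1 - δ) u)) := by
  have hle : δ ≤ 1 - δ := by linarith
  have hc : Continuous (fun u : Set.Icc δ (1 - δ) => quantile F u) := by
    rw [continuous_iff_continuousAt]
    intro u
    exact ContinuousAt.comp (f := Subtype.val)
      (hF.continuousAt_quantile ⟨hδ.trans_le u.2.1, u.2.2.trans_lt (by linarith)⟩)
      continuous_subtype_val.continuousAt
  have h1 := CompactSpace.uniformContinuous_of_continuous hc
  have h2 := h1.comp (LipschitzWith.projIcc hle).uniformContinuous
  exact h2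

end IsRegular

/-! ### The empirical distribution function -/

section Empirical

variable {ι : Type*} [Fintype ι]

theorem empCDF_eq_sum (x : ι → ℝ) (t : ℝ) :
    empCDF x t = (∑ i, Set.indicator (Set.Iic t) (fun _ => (1 : ℝ)) (x i)) / Fintype.card ι := by
  classical
  rw [empCDF, Nat.card_eq_fintype_card, Fintype.card_subtype, Finset.card_filter]
  push_cast
  simp only [Set.indicator, Set.mem_Iic]

theorem empCDF_mono_of_imp {x y : ι → ℝ} {s t : ℝ} (h : ∀ i, x i ≤ s → y i ≤ t) :
    empCDF x s ≤ empCDF y t := by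
  rw [empCDF_eq_sum, empCDF_eq_sum]
  gcongr with i
  by_cases hi : x i ≤ s
  · simp [Set.indicator, hi, h i hi]
  · rw [Set.indicator_of_notMem (by simpa using hi)]
    exact Set.indicator_nonneg (fun _ _ => zero_le_one) _

theorem monotone_empCDF (x : ι → ℝ) : Monotone (empCDF x) := fun _ _ h =>
  empCDF_mono_of_imp fun _ hi => hi.trans h

theorem empCDF_mem_Icc (x : ι → ℝ) (t : ℝ) : empCDF x t ∈ Set.Icc (0 : ℝ) 1 := by
  refine ⟨by unfold empCDF; positivity, ?_⟩
  rw [empCDF_eq_sum]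
  refine div_le_one_of_le₀ ?_ (by positivity)
  calc _ ≤ ∑ _i : ι, (1 : ℝ) := Finset.sum_le_sum fun i _ =>
        Set.indicator_le_self' (fun _ _ => zero_le_one) _
    _ = _ := by simp

theorem exists_empCDF_lt (x : ι → ℝ) {p : ℝ} (hp : 0 < p) : ∃ t, empCDF x t < p := by
  obtain ⟨t, ht⟩ := (Set.finite_range x).bddBelow
  refine ⟨t - 1, ?_⟩
  rw [empCDF_eq_sum, Finset.sum_eq_zero]
  · simpa using hp
  · intro i _
    refine Set.indicator_of_notMem ?_ _
    have := ht (Set.mem_range_self i)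
    simp only [Set.mem_Iic, not_le]; linarith

theorem exists_le_empCDF [Nonempty ι] (x : ι → ℝ) {p : ℝ} (hp : p ≤ 1) : ∃ t, p ≤ empCDF x t := by
  obtain ⟨t, ht⟩ := (Set.finite_range x).bddAbove
  refine ⟨t, hp.trans ?_⟩
  rw [empCDF_eq_sum, le_div_iff₀ (by exact_mod_cast Fintype.card_pos), one_mul]
  rw [Finset.sum_congr rfl (g := fun _ => (1 : ℝ))]
  · simp
  · intro i _
    exact Set.indicator_of_mem (Set.mem_Iic.2 (ht (Set.mem_range_self i))) (fun _ => (1 : ℝ))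

/-- If the transforms `F (x i)` are nearly uniformly distributed, then each is close to the
normalized rank of `x i`. -/
theorem abs_empCDF_sub_le {F : ℝ → ℝ} (hF : Monotone F) (h01 : ∀ x, F x ∈ Set.Icc (0 : ℝ) 1)
    (x : ι → ℝ) {η : ℝ} (h : ∀ u, |empCDF (fun i => F (x i)) u - clampUnit u| ≤ η) (i : ι) :
    |empCDF x (x i) - F (x i)| ≤ η := by
  rw [abs_le]
  constructor
  -- The level is lowered by `ε` because `F` may be flat: `F (x j) ≤ F (x i)` does not imply `x j ≤
  -- x i`, whereas `F (x j) ≤ F (x i) - ε` does.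
  · refine le_of_forall_pos_le_add fun ε hε => ?_
    have h1 : empCDF (fun i => F (x i)) (F (x i) - ε) ≤ empCDF x (x i) := by
      refine empCDF_mono_of_imp fun j hj => ?_
      by_contra! hc
      have := hF hc.le
      linarith
    have h2 := (abs_le.1 (h (F (x i) - ε))).1
    have h3 : F (x i) - ε ≤ clampUnit (F (x i) - ε) :=
      le_max_of_le_right (le_min (by linarith [(h01 (x i)).2]) le_rfl)
    linarith
  · have h1 : empCDF x (x i) ≤ empCDF (fun i => F (x i)) (F (x i)) :=
      empCDF_mono_of_imp fun j hj => hF hj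
    have h2 := (abs_le.1 (h (F (x i)))).2
    rw [clampUnit_of_mem (h01 _)] at h2
    linarith

end Empirical

/-! ### The truncated aggregation of a copula vector -/

section Aggregation

variable {L : ℕ}

/-- The aggregation `φ ∘ S ∘ F⁻¹` of a copula vector, with the coordinates cut off to
`[δ, 1 - δ]`. -/
noncomputable def truncAgg (F : ℝ → ℝ) (S : (Fin L → ℝ) → ℝ) (φ : ℝ → ℝ) (δ : ℝ)
    (u : Fin L → ℝ) : ℝ :=
  φ (S fun l => quantile F (max δ (min (1 - δ) (u l))))

/-- The number of coordinates of `u` outside of `(2δ, 1 - 2δ]`. -/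
noncomputable def tailCount (δ : ℝ) (u : Fin L → ℝ) : ℝ :=
  ∑ l, (Set.indicator (Set.Iic (2 * δ)) (fun _ => (1 : ℝ)) (u l) + 1
    - Set.indicator (Set.Iic (1 - 2 * δ)) (fun _ => (1 : ℝ)) (u l))

theorem uniformContinuous_truncAgg {F : ℝ → ℝ} (hF : IsRegular F) {S : (Fin L → ℝ) → ℝ}
    (hS : UniformContinuous S) {φ : ℝ → ℝ} (hφ : UniformContinuous φ) {δ : ℝ} (hδ : 0 < δ)
    (hδ' : δ ≤ 1 / 2) : UniformContinuous (truncAgg F S φ δ) := by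
  refine hφ.comp (hS.comp (uniformContinuous_pi.2 fun l => ?_))
  exact (hF.uniformContinuous_quantile_clamp hδ hδ').comp (Pi.uniformContinuous_proj _ l)

theorem truncAgg_mem_Icc {F : ℝ → ℝ} {S : (Fin L → ℝ) → ℝ} {φ : ℝ → ℝ}
    (hφ : ∀ s, φ s ∈ Set.Icc (0 : ℝ) 1) (δ : ℝ) (u : Fin L → ℝ) :
    truncAgg F S φ δ u ∈ Set.Icc (0 : ℝ) 1 := hφ _

/-- Here `r` approximates the copula vector `u` and has `F`-quantiles `t`. If all `r l` lie in `[δ,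
1 - δ]`, the truncation at `r` is inactive and only `ε` is lost. Otherwise some `u l` lies outside
`(2δ, 1 - 2δ]`, because `η ≤ δ`, and the tail count, at least one, dominates a difference of two
numbers in `[0, 1]`. It serves twice: with `r = F₀(T)` under the null, and with `r` the shifted
normalized ranks. -/
theorem abs_sub_truncAgg_le {F : ℝ → ℝ} {S : (Fin L → ℝ) → ℝ} {φ : ℝ → ℝ}
    (hφ : ∀ s, φ s ∈ Set.Icc (0 : ℝ) 1) {δ η ε : ℝ} (hδ : 0 < δ) (hη : η ≤ δ) (hε : 0 ≤ ε)
    {t r u : Fin L → ℝ} (hru : ∀ l, |r l - u l| ≤ η)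
    (hg : |truncAgg F S φ δ r - truncAgg F S φ δ u| ≤ ε)
    (ht : ∀ l, r l ∈ Set.Ioo (0 : ℝ) 1 → quantile F (r l) = t l) :
    |φ (S t) - truncAgg F S φ δ u| ≤ ε + tailCount δ u := by
  have hnn : ∀ l, 0 ≤ Set.indicator (Set.Iic (2 * δ)) (fun _ => (1 : ℝ)) (u l) + 1
      - Set.indicator (Set.Iic (1 - 2 * δ)) (fun _ => (1 : ℝ)) (u l) := fun l => by
    have h1 : 0 ≤ Set.indicator (Set.Iic (2 * δ)) (fun _ => (1 : ℝ)) (u l) :=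
      Set.indicator_nonneg (fun _ _ => zero_le_one) _
    have h2 : Set.indicator (Set.Iic (1 - 2 * δ)) (fun _ => (1 : ℝ)) (u l) ≤ 1 :=
      Set.indicator_le_self' (f := fun _ => (1 : ℝ)) (fun _ _ => zero_le_one) _
    linarith
  by_cases hr : ∀ l, r l ∈ Set.Icc δ (1 - δ)
  · have : φ (S t) = truncAgg F S φ δ r := by
      rw [truncAgg]
      congr 2
      ext l
      rw [min_eq_right (hr l).2, max_eq_right (hr l).1,
        ht l ⟨hδ.trans_le (hr l).1, (hr l).2.trans_lt (by linarith)⟩]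
    rw [this]
    have := Finset.sum_nonneg fun l (_ : l ∈ Finset.univ) => hnn l
    unfold tailCount
    linarith
  · push Not at hr
    obtain ⟨l, hl⟩ := hr
    have hul := abs_le.1 (hru l)
    have hone : 1 ≤ Set.indicator (Set.Iic (2 * δ)) (fun _ => (1 : ℝ)) (u l) + 1
        - Set.indicator (Set.Iic (1 - 2 * δ)) (fun _ => (1 : ℝ)) (u l) := by
      rw [Set.mem_Icc, not_and_or, not_le, not_le] at hl
      rcases hl with hl | hl
      · rw [Set.indicator_of_mem (by simp only [Set.mem_Iic]; linarith)]
        have h2 : Set.indicator (Set.Iic (1 - 2 * δ)) (fun _ => (1 : ℝ)) (u l) ≤ 1 :=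
          Set.indicator_le_self' (f := fun _ => (1 : ℝ)) (fun _ _ => zero_le_one) _
        linarith
      · rw [Set.indicator_of_notMem (s := Set.Iic (1 - 2 * δ))
          (by simp only [Set.mem_Iic, not_le]; linarith)]
        have h1 : 0 ≤ Set.indicator (Set.Iic (2 * δ)) (fun _ => (1 : ℝ)) (u l) :=
          Set.indicator_nonneg (fun _ _ => zero_le_one) _
        linarith
    have hsum := Finset.single_le_sum (fun l (_ : l ∈ Finset.univ) => hnn l) (Finset.mem_univ l)
    have h1 := hφ (S t)
    have h2 := truncAgg_mem_Icc (F := F) (S := S) hφ δ u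
    unfold tailCount
    rw [abs_le]
    constructor <;> linarith [h1.1, h1.2, h2.1, h2.2]

end Aggregation

/-! ### The law of the subsamples -/

/-- Picking distinct coordinates of an i.i.d. sample gives an i.i.d. sample. -/
theorem measurePreserving_comp_injective {ι κ 𝒴 : Type*} [Fintype ι] [Fintype κ]
    [MeasurableSpace 𝒴] (μ : Measure 𝒴) [IsProbabilityMeasure μ] {e : κ → ι}
    (he : Function.Injective e) :
    MeasurePreserving (fun (x : ι → 𝒴) k => x (e k)) (Measure.pi fun _ => μ)
      (Measure.pi fun _ => μ) := by
  classical
  have hm : Measurable (fun (x : ι → 𝒴) k => x (e k)) := by fun_prop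
  refine ⟨hm, (Measure.pi_eq fun s hs => ?_).symm⟩
  rw [Measure.map_apply hm (MeasurableSet.univ_pi hs)]
  set t : ι → Set 𝒴 := fun i => if h : ∃ k, e k = i then s h.choose else Set.univ with ht
  have hte : ∀ k, t (e k) = s k := fun k => by
    have h : ∃ k', e k' = e k := ⟨k, rfl⟩
    simp only [ht, dif_pos h, he h.choose_spec]
  have hpre : (fun (x : ι → 𝒴) k => x (e k)) ⁻¹' Set.univ.pi s = Set.univ.pi t := by
    ext x
    simp only [Set.mem_preimage, Set.mem_pi, Set.mem_univ, forall_true_left]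
    constructor
    · intro h i
      by_cases hi : ∃ k, e k = i
      · obtain ⟨k, rfl⟩ := hi
        rw [hte]; exact h k
      · simp only [ht, dif_neg hi, Set.mem_univ]
    · intro h k
      rw [← hte]; exact h _
  rw [hpre, Measure.pi_pi]
  rw [← Finset.prod_subset (Finset.subset_univ (Finset.univ.image e))]
  · rw [Finset.prod_image fun a _ b _ h => he h]
    exact Finset.prod_congr rfl fun k _ => by rw [hte]
  · intro i _ hi
    have : ¬ ∃ k, e k = i := fun ⟨k, hk⟩ => hi (Finset.mem_image.2 ⟨k, Finset.mem_univ _, hk⟩)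
    simp only [ht, dif_neg this, measure_univ]

theorem measurePreserving_curry {ι κ 𝒴 : Type*} [Fintype ι] [Fintype κ]
    [MeasurableSpace 𝒴] (μ : Measure 𝒴) [IsProbabilityMeasure μ] :
    MeasurePreserving (fun (x : ι × κ → 𝒴) i j => x (i, j)) (Measure.pi fun _ => μ)
      (Measure.pi fun _ => Measure.pi fun _ => μ) := by
  refine ⟨by fun_prop, ?_⟩
  have h := Measure.infinitePi_map_curry (ι := ι) (κ := κ) (fun _ _ => μ)
  simp only [Measure.infinitePi_eq_pi] at h
  exact h

/-- Division with remainder by `m` recovers block and position. Disjointness of the blocks is the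
source of their independence. -/
theorem block_injective {n m : ℕ} (π : Equiv.Perm (Fin n)) :
    Function.Injective fun p : Fin (n / m) × Fin m => block π p.1 p.2 := by
  rintro ⟨k, i⟩ ⟨k', i'⟩ h
  have h1 := congrArg Fin.val (π.injective h)
  simp only at h1
  have hm : 0 < m := i.pos
  have hk : (k : ℕ) = k' := by
    have := congrArg (· / m) h1
    simpa [Nat.add_div_of_dvd_right, Nat.div_eq_of_lt, hm] using this
  have hi : (i : ℕ) = i' := by rw [hk] at h1; omega
  exact Prod.ext (Fin.ext hk) (Fin.ext hi)

section Rows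

variable {𝒳 𝒲 : Type*} [MeasurableSpace 𝒳] [MeasurableSpace 𝒲] {L : ℕ}

/-- The inputs (subsample and regenerated randomness) of the statistics on the blocks of one
permutation. -/
def rowInput {n m J : ℕ} (j : Fin J) (π : Fin J → Equiv.Perm (Fin n))
    (z : (Fin n → 𝒳) × (SubIdx n m J → 𝒲)) : Fin (n / m) → (Fin m → 𝒳) × 𝒲 :=
  fun k => (fun i => z.1 (block (π j) k i), z.2 (j, k))

/-- For frozen permutations, the blocks of the `j`-th one read distinct coordinates of the sample
and distinct copies of the randomness, so the inputs are i.i.d. -/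
theorem measurePreserving_rowInput (PΩ : Measure 𝒲) [IsProbabilityMeasure PΩ]
    (P : ProbabilityMeasure 𝒳) {n m J : ℕ} (j : Fin J) (π : Fin J → Equiv.Perm (Fin n)) :
    MeasurePreserving (rowInput (m := m) (𝒳 := 𝒳) (𝒲 := 𝒲) j π)
      ((Measure.pi fun _ => (P : Measure 𝒳)).prod (Measure.pi fun _ => PΩ))
      (Measure.pi fun _ => sampleLaw PΩ P m) := by
  have h1 := (measurePreserving_curry (ι := Fin (n / m)) (κ := Fin m) (P : Measure 𝒳)).comp
    (measurePreserving_comp_injective (P : Measure 𝒳) (block_injective (m := m) (π j)))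
  have h2 := measurePreserving_comp_injective PΩ
    (e := fun k : Fin (n / m) => ((j, k) : SubIdx n m J)) (Prod.mk_right_injective j)
  have h3 := (measurePreserving_arrowProdEquivProdArrow (Fin m → 𝒳) 𝒲 (Fin (n / m))
    (fun _ => Measure.pi fun _ => (P : Measure 𝒳)) (fun _ => PΩ)).symm
  exact h3.comp (h1.prod h2)

instance (n : ℕ) : DiscreteMeasurableSpace (Equiv.Perm (Fin n)) := ⟨fun _ => trivial⟩

instance (PΩ : Measure 𝒲) [IsProbabilityMeasure PΩ] (P : ProbabilityMeasure 𝒳) (n m J : ℕ) :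
    IsProbabilityMeasure (drawLaw PΩ P n m J) := by
  unfold drawLaw; infer_instance

/-- The subsamples of one permutation, with their regenerated randomness, are i.i.d. -/
theorem measurePreserving_rowInput_drawLaw (PΩ : Measure 𝒲) [IsProbabilityMeasure PΩ]
    (P : ProbabilityMeasure 𝒳) {n m J : ℕ} (j : Fin J) :
    MeasurePreserving (fun d : Draw 𝒳 𝒲 n m J => rowInput j d.2.1 (d.1.1, d.2.2))
      (drawLaw PΩ P n m J) (Measure.pi fun _ => sampleLaw PΩ P m) := by
  set μX := Measure.pi fun _ : Fin n => (P : Measure 𝒳)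
  set μπ := Measure.pi fun _ : Fin J => (PMF.uniformOfFintype (Equiv.Perm (Fin n))).toMeasure
  set μω := Measure.pi fun _ : SubIdx n m J => PΩ
  have h1 : MeasurePreserving
      (fun d : Draw 𝒳 𝒲 n m J => (d.2.1, (d.1.1, d.2.2)))
      (drawLaw PΩ P n m J) (μπ.prod (μX.prod μω)) := by
    have a1 : MeasurePreserving (Prod.map Prod.fst id) (drawLaw PΩ P n m J)
        (μX.prod (μπ.prod μω)) := measurePreserving_fst.prod (MeasurePreserving.id _)
    have a2 := (measurePreserving_prodAssoc μπ μω μX).comp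
      (Measure.measurePreserving_swap (μ := μX) (ν := μπ.prod μω))
    have a3 := (MeasurePreserving.id μπ).prod (Measure.measurePreserving_swap (μ := μω) (ν := μX))
    exact a3.comp (a2.comp a1)
  -- The conditional law given the permutations does not depend on them, so it is also the
  -- unconditional law.
  have h2 := (MeasurePreserving.id μπ).skew_product
    (g := fun π z => rowInput (m := m) (𝒳 := 𝒳) (𝒲 := 𝒲) j π z)
    (measurable_from_prod_countable_right fun π =>
      (measurePreserving_rowInput PΩ P (m := m) j π).measurable)
    (ae_of_all _ fun π => (measurePreserving_rowInput PΩ P (m := m) j π).map_eq)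
  exact measurePreserving_snd.comp (h2.comp h1)

/-! ### The law of large numbers for the rows -/

/-- Chebyshev's inequality, with the crude bound 1 for the variance of a `[0, 1]`-valued variable.
-/
theorem measure_le_abs_mean_sub_le {𝒴 : Type*} [MeasurableSpace 𝒴] (ν : Measure 𝒴)
    [IsProbabilityMeasure ν] {f : 𝒴 → ℝ} (hf : Measurable f) (h01 : ∀ y, f y ∈ Set.Icc (0 : ℝ) 1)
    {K : ℕ} (hK : 0 < K) {ε : ℝ} (hε : 0 < ε) :
    (Measure.pi fun _ : Fin K => ν) {y | ε ≤ |(∑ k, f (y k)) / K - ∫ y, f y ∂ν|}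
      ≤ ENNReal.ofReal (1 / (K * ε ^ 2)) := by
  have hK' : (0 : ℝ) < K := by exact_mod_cast hK
  have hfL : MemLp f 2 ν := memLp_of_bounded (ae_of_all _ h01) hf.aestronglyMeasurable 2
  have hYL : ∀ k : Fin K, MemLp (fun y : Fin K → 𝒴 => f (y k)) 2 (Measure.pi fun _ => ν) :=
    fun k => hfL.comp_measurePreserving (measurePreserving_eval _ k)
  have hsumL : MemLp (∑ k, fun y : Fin K → 𝒴 => f (y k)) 2 (Measure.pi fun _ => ν) :=
    memLp_finsetSum' _ fun k _ => hYL k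
  have hmean : ∫ y, (∑ k, fun y : Fin K → 𝒴 => f (y k)) y ∂(Measure.pi fun _ => ν)
      = K * ∫ y, f y ∂ν := by
    simp only [Finset.sum_apply]
    rw [integral_finsetSum _ fun k _ => (hYL k).integrable one_le_two]
    have : ∀ k : Fin K, ∫ y : Fin K → 𝒴, f (y k) ∂(Measure.pi fun _ => ν) = ∫ y, f y ∂ν := by
      intro k
      have h := (measurePreserving_eval (fun _ : Fin K => ν) k)
      conv_rhs => rw [← h.map_eq]
      rw [integral_map h.measurable.aemeasurable hf.aestronglyMeasurable]
    simp [this]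
  have hvar : Var[∑ k, fun y : Fin K → 𝒴 => f (y k); Measure.pi fun _ => ν] ≤ K := by
    rw [variance_sum_pi (X := fun _ => f) fun _ => hfL]
    have := variance_le_sq_of_bounded (μ := ν) (ae_of_all _ h01) hf.aemeasurable
    calc ∑ _k : Fin K, Var[f; ν] ≤ ∑ _k : Fin K, (1 : ℝ) := by
          gcongr; refine this.trans ?_; norm_num
      _ = K := by simp
  have hch := meas_ge_le_variance_div_sq hsumL (c := K * ε) (by positivity)
  rw [hmean] at hch
  refine (measure_mono ?_).trans (hch.trans (ENNReal.ofReal_le_ofReal ?_))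
  · intro y hy
    simp only [Set.mem_ofPred_eq, Finset.sum_apply] at hy ⊢
    have : (∑ k, f (y k)) - K * ∫ y, f y ∂ν = K * ((∑ k, f (y k)) / K - ∫ y, f y ∂ν) := by
      field_simp
    rw [this, abs_mul, abs_of_pos hK']
    gcongr
  · rw [div_le_div_iff₀ (by positivity) (by positivity)]
    calc _ ≤ (K : ℝ) * (K * ε ^ 2) := by gcongr
      _ = _ := by ring

/-- The average of a function over the rows of the matrix of subsample statistics. -/
noncomputable def rowMean {ι : Type*} [Fintype ι] (H : ι → Fin L → ℝ) (g : (Fin L → ℝ) → ℝ) : ℝ :=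
  (∑ b, g (H b)) / Fintype.card ι

/-- Rows from different permutations share data and are dependent. The mean is therefore split into
`J` means over i.i.d. rows: a deviation of the total forces a deviation for some permutation, and a
union bound costs the factor `J`. -/
theorem drawLaw_le_abs_rowMean_sub_le (PΩ : Measure 𝒲) [IsProbabilityMeasure PΩ]
    (P : ProbabilityMeasure 𝒳) {n m J : ℕ} (hJ : 0 < J) (hnm : 0 < n / m)
    {T : (n : ℕ) → (Fin n → 𝒳) × 𝒲 → Fin L → ℝ} (hT : ∀ n, Measurable (T n))
    {g : (Fin L → ℝ) → ℝ} (hg : Measurable g) (h01 : ∀ t, g t ∈ Set.Icc (0 : ℝ) 1)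
    {ε : ℝ} (hε : 0 < ε) :
    drawLaw PΩ P n m J {d | ε ≤ |rowMean (subStats T d) g - ∫ z, g (T m z) ∂(sampleLaw PΩ P m)|}
      ≤ J * ENNReal.ofReal (1 / ((n / m : ℕ) * ε ^ 2)) := by
  set E := ∫ z, g (T m z) ∂(sampleLaw PΩ P m)
  have hf : Measurable fun z => g (T m z) := hg.comp (hT m)
  set A : Fin J → Set (Draw 𝒳 𝒲 n m J) := fun j =>
    (fun d : Draw 𝒳 𝒲 n m J => rowInput j d.2.1 (d.1.1, d.2.2)) ⁻¹'
      {y | ε ≤ |(∑ k, g (T m (y k))) / (n / m : ℕ) - E|} with hA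
  have hAle : ∀ j, drawLaw PΩ P n m J (A j) ≤ ENNReal.ofReal (1 / ((n / m : ℕ) * ε ^ 2)) := by
    intro j
    rw [hA, (measurePreserving_rowInput_drawLaw PΩ P j).measure_preimage]
    · exact measure_le_abs_mean_sub_le _ hf (fun _ => h01 _) hnm hε
    · refine (measurableSet_le measurable_const ?_).nullMeasurableSet
      refine Measurable.abs (Measurable.sub_const (Measurable.div_const ?_ _) _)
      exact Finset.measurable_fun_sum _ fun k _ => hf.comp (measurable_pi_apply k)
  have hsub : {d | ε ≤ |rowMean (subStats T d) g - E|} ⊆ ⋃ j, A j := by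
    intro d hd
    by_contra hc
    simp only [hA, Set.mem_iUnion, Set.mem_preimage, Set.mem_ofPred_eq, not_exists, not_le] at hc
    have hJ' : (0 : ℝ) < J := by exact_mod_cast hJ
    have hK' : (0 : ℝ) < (n / m : ℕ) := by exact_mod_cast hnm
    have heq : rowMean (subStats T d) g - E
        = (∑ j : Fin J, ((∑ k, g (T m (rowInput j d.2.1 (d.1.1, d.2.2) k))) / (n / m : ℕ) - E))
          / J := by
      have h1 : ∑ b, g (subStats T d b)
          = ∑ j : Fin J, ∑ k, g (T m (rowInput j d.2.1 (d.1.1, d.2.2) k)) := by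
        rw [Fintype.sum_prod_type]; rfl
      rw [rowMean, h1, Finset.sum_sub_distrib, ← Finset.sum_div]
      simp only [Fintype.card_prod, Fintype.card_fin, Nat.cast_mul, Finset.sum_const,
        Finset.card_univ, nsmul_eq_mul]
      field_simp
    have hlt : |rowMean (subStats T d) g - E| < ε := by
      rw [heq, abs_div, abs_of_pos hJ', div_lt_iff₀ hJ']
      refine (Finset.abs_sum_le_sum_abs _ _).trans_lt ?_
      have hne : (Finset.univ : Finset (Fin J)).Nonempty := ⟨⟨0, hJ⟩, Finset.mem_univ _⟩
      calc _ < ∑ _j : Fin J, ε := Finset.sum_lt_sum_of_nonempty hne fun j _ => hc j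
        _ = ε * J := by simp [mul_comm]
    exact absurd hlt (not_lt.2 hd)
  calc _ ≤ drawLaw PΩ P n m J (⋃ j, A j) := measure_mono hsub
    _ ≤ ∑ j, drawLaw PΩ P n m J (A j) := measure_iUnion_fintype_le _ _
    _ ≤ ∑ _j : Fin J, ENNReal.ofReal (1 / ((n / m : ℕ) * ε ^ 2)) :=
      Finset.sum_le_sum fun j _ => hAle j
    _ = _ := by simp

theorem tendsto_div_atTop {m : ℕ → ℕ} (hm : Tendsto m atTop atTop)
    (hmn : Tendsto (fun n : ℕ => (m n : ℝ) / (n : ℝ)) atTop (𝓝 0)) :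
    Tendsto (fun n => n / m n) atTop atTop := by
  rw [tendsto_atTop]
  intro K
  have h := hmn.eventually (gt_mem_nhds (show (0 : ℝ) < 1 / ((K : ℝ) + 1) by positivity))
  filter_upwards [h, hm.eventually_gt_atTop 0, eventually_gt_atTop 0] with n h1 h2 h3
  rw [Nat.le_div_iff_mul_le h2]
  have hn : (0 : ℝ) < n := by exact_mod_cast h3
  rw [div_lt_div_iff₀ hn (by positivity)] at h1
  have : (K : ℝ) * m n ≤ n := by
    have : (0 : ℝ) ≤ m n := by positivity
    nlinarith
  exact_mod_cast this

/-- The law of large numbers for the rows of the matrix of subsample statistics. -/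
theorem tendsto_rowMean (PΩ : Measure 𝒲) [IsProbabilityMeasure PΩ] {J : ℕ} (hJ : 0 < J)
    {m : ℕ → ℕ} (hmn : Tendsto (fun n => n / m n) atTop atTop)
    {T : (n : ℕ) → (Fin n → 𝒳) × 𝒲 → Fin L → ℝ} (hT : ∀ n, Measurable (T n))
    (P : ℕ → ProbabilityMeasure 𝒳) {g : ℕ → (Fin L → ℝ) → ℝ} (hg : ∀ n, Measurable (g n))
    (h01 : ∀ n t, g n t ∈ Set.Icc (0 : ℝ) 1) {c : ℝ}
    (hc : Tendsto (fun n => ∫ z, g n (T (m n) z) ∂(sampleLaw PΩ (P n) (m n))) atTop (𝓝 c)) :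
    Tendsto (fun x : Σ n, Draw 𝒳 𝒲 n (m n) J => rowMean (subStats T x.2) (g x.1))
      (whp fun n => drawLaw PΩ (P n) n (m n) J) (𝓝 c) := by
  rw [Metric.tendsto_nhds]
  intro ε hε
  have h1 : ∀ᶠ x : Σ n, Draw 𝒳 𝒲 n (m n) J in whp fun n => drawLaw PΩ (P n) n (m n) J,
      |∫ z, g x.1 (T (m x.1) z) ∂(sampleLaw PΩ (P x.1) (m x.1)) - c| < ε / 2 :=
    eventually_whp_of_eventually (p := fun n =>
      |∫ z, g n (T (m n) z) ∂(sampleLaw PΩ (P n) (m n)) - c| < ε / 2)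
      ((Metric.tendsto_nhds.1 hc (ε / 2) (by positivity)))
  have h2 : ∀ᶠ x : Σ n, Draw 𝒳 𝒲 n (m n) J in whp fun n => drawLaw PΩ (P n) n (m n) J,
      ¬ (ε / 2 ≤ |rowMean (subStats T x.2) (g x.1)
        - ∫ z, g x.1 (T (m x.1) z) ∂(sampleLaw PΩ (P x.1) (m x.1))|) := by
    rw [eventually_whp]
    simp only [not_not]
    have hlim : Tendsto (fun n => (J : ℝ≥0∞) *
        ENNReal.ofReal (1 / ((n / m n : ℕ) * (ε / 2) ^ 2))) atTop (𝓝 0) := by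
      have a1 : Tendsto (fun n => (1 : ℝ) / ((n / m n : ℕ) * (ε / 2) ^ 2)) atTop (𝓝 0) := by
        refine Tendsto.div_atTop tendsto_const_nhds ?_
        exact Tendsto.atTop_mul_const (by positivity)
          (tendsto_natCast_atTop_atTop.comp hmn)
      have a2 := ENNReal.tendsto_ofReal a1
      rw [ENNReal.ofReal_zero] at a2
      have a3 := ENNReal.Tendsto.const_mul (a := (J : ℝ≥0∞)) a2
        (Or.inr (ENNReal.natCast_ne_top J))
      rwa [mul_zero] at a3
    refine tendsto_of_tendsto_of_tendsto_of_le_of_le' tendsto_const_nhds hlim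
      (Eventually.of_forall fun _ => zero_le) ?_
    filter_upwards [hmn.eventually_gt_atTop 0] with n hn
    exact drawLaw_le_abs_rowMean_sub_le PΩ (P n) hJ hn hT (hg n) (h01 n) (by positivity)
  filter_upwards [h1, h2] with x hx1 hx2
  rw [Real.dist_eq]
  have := abs_sub_le (rowMean (subStats T x.2) (g x.1))
    (∫ z, g x.1 (T (m x.1) z) ∂(sampleLaw PΩ (P x.1) (m x.1))) c
  linarith [not_le.1 hx2]

end Rows

/-! ### Consequences of convergence in distribution -/

section Distribution

variable {Ω : ℕ → Type*} [∀ n, MeasurableSpace (Ω n)] {μ : ∀ n, Measure (Ω n)}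
  [∀ n, IsProbabilityMeasure (μ n)]

theorem tendsto_integral_of_tendstoInDistribution {E : Type*} [TopologicalSpace E]
    [MeasurableSpace E] [OpensMeasurableSpace E] {X : ∀ n, Ω n → E} {Q : Measure E}
    [IsProbabilityMeasure Q] (h : TendstoInDistribution X atTop id μ Q) {g : E → ℝ}
    (hg : Continuous g) (h01 : ∀ x, g x ∈ Set.Icc (0 : ℝ) 1) :
    Tendsto (fun n => ∫ z, g (X n z) ∂(μ n)) atTop (𝓝 (∫ x, g x ∂Q)) := by
  have h1 := (ProbabilityMeasure.tendsto_iff_forall_integral_tendsto.1 h.tendsto)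
    (BoundedContinuousFunction.ofNormedAddCommGroup g hg 1 fun x => by
      rw [Real.norm_eq_abs, abs_of_nonneg (h01 x).1]; exact (h01 x).2)
  simp only [ProbabilityMeasure.coe_mk, BoundedContinuousFunction.coe_ofNormedAddCommGroup,
    Measure.map_id] at h1
  refine h1.congr fun n => ?_
  exact integral_map (h.forall_aemeasurable n) hg.measurable.aestronglyMeasurable

theorem tendsto_measure_of_tendstoInDistribution {E : Type*} [TopologicalSpace E]
    [MeasurableSpace E] [OpensMeasurableSpace E] [HasOuterApproxClosed E] {X : ∀ n, Ω n → E}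
    {Q : Measure E} [IsProbabilityMeasure Q] (h : TendstoInDistribution X atTop id μ Q)
    {s : Set E} (hs : MeasurableSet s) (hfr : Q (frontier s) = 0) :
    Tendsto (fun n => (μ n).real {z | X n z ∈ s}) atTop (𝓝 (Q.real s)) := by
  have h1 := ProbabilityMeasure.tendsto_measure_of_null_frontier_of_tendsto' h.tendsto (E := s)
    (by simpa using hfr)
  simp only [ProbabilityMeasure.coe_mk, Measure.map_id] at h1
  refine ((ENNReal.tendsto_toReal (measure_ne_top Q s)).comp h1).congr fun n => ?_
  simp only [Function.comp, measureReal_def]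
  rw [Measure.map_apply_of_aemeasurable (h.forall_aemeasurable n) hs]
  rfl

theorem tendstoInDistribution_coordinate {L : ℕ} {X : ∀ n, Ω n → Fin L → ℝ}
    {C : Measure (Fin L → ℝ)} [IsProbabilityMeasure C]
    (h : TendstoInDistribution X atTop id μ C) (l : Fin L)
    [IsProbabilityMeasure (C.map fun u => u l)] :
    TendstoInDistribution (fun n z => X n z l) atTop id μ (C.map fun u => u l) where
  forall_aemeasurable n := (measurable_pi_apply l).comp_aemeasurable (h.forall_aemeasurable n)
  aemeasurable_limit := aemeasurable_id
  tendsto := by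
    have h1 := (h.continuous_comp (continuous_apply l)).tendsto
    simp only [Measure.map_id]
    exact h1

theorem tendsto_real_le_of_tendstoInDistribution {X : ∀ n, Ω n → ℝ} {Q : Measure ℝ}
    [IsProbabilityMeasure Q] (h : TendstoInDistribution X atTop id μ Q) {x : ℝ} (hx : Q {x} = 0) :
    Tendsto (fun n => (μ n).real {z | X n z ≤ x}) atTop (𝓝 (Q.real (Set.Iic x))) :=
  tendsto_measure_of_tendstoInDistribution h measurableSet_Iic (by rwa [frontier_Iic])

/-- A limit law is uniform on `(0, 1)` as soon as the distribution functions converge to that of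
the uniform distribution there. -/
theorem uniform_of_tendstoInDistribution {X : ∀ n, Ω n → ℝ} {Q : Measure ℝ}
    [IsProbabilityMeasure Q] (h : TendstoInDistribution X atTop id μ Q)
    (hX : ∀ v ∈ Set.Ioo (0 : ℝ) 1, Tendsto (fun n => (μ n).real {z | X n z ≤ v}) atTop (𝓝 v)) :
    ∀ v ∈ Set.Ioo (0 : ℝ) 1, Q {v} = 0 ∧ Q.real (Set.Iic v) = v := by
  have hlim : ∀ v ∈ Set.Ioo (0 : ℝ) 1,
      Tendsto (fun n => (μ n).map (X n) (Set.Iic v)) atTop (𝓝 (ENNReal.ofReal v)) := by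
    intro v hv
    refine (ENNReal.tendsto_ofReal (hX v hv)).congr fun n => ?_
    rw [Measure.map_apply_of_aemeasurable (h.forall_aemeasurable n) measurableSet_Iic,
      ofReal_measureReal]
    rfl
  -- The portmanteau inequalities for closed and open half-lines give `Q (Iio v) ≤ v ≤ Q (Iic v)`,
  -- and letting levels decrease to `v` closes the gap.
  have hge : ∀ v ∈ Set.Ioo (0 : ℝ) 1, v ≤ Q.real (Set.Iic v) := by
    intro v hv
    have h1 := ProbabilityMeasure.limsup_measure_closed_le_of_tendsto h.tendsto
      (isClosed_Iic (a := v))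
    simp only [ProbabilityMeasure.coe_mk, Measure.map_id] at h1
    rw [(hlim v hv).limsup_eq] at h1
    exact (ENNReal.ofReal_le_iff_le_toReal (measure_ne_top _ _)).1 h1
  have hlt : ∀ v ∈ Set.Ioo (0 : ℝ) 1, Q.real (Set.Iio v) ≤ v := by
    intro v hv
    have h1 := ProbabilityMeasure.le_liminf_measure_open_of_tendsto h.tendsto
      (isOpen_Iio (a := v))
    simp only [ProbabilityMeasure.coe_mk, Measure.map_id] at h1
    have h2 : Q (Set.Iio v) ≤ ENNReal.ofReal v := by
      rw [← (hlim v hv).liminf_eq]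
      exact h1.trans (liminf_le_liminf
        (Eventually.of_forall fun n => measure_mono Set.Iio_subset_Iic_self))
    exact ENNReal.toReal_le_of_le_ofReal hv.1.le h2
  have heq : ∀ v ∈ Set.Ioo (0 : ℝ) 1, Q.real (Set.Iic v) = v := by
    intro v hv
    refine le_antisymm (le_of_forall_gt_imp_ge_of_dense fun w hw => ?_) (hge v hv)
    rcases lt_or_ge w 1 with hw1 | hw1
    · exact (measureReal_mono (Set.Iic_subset_Iio.2 hw)).trans (hlt w ⟨hv.1.trans hw, hw1⟩)
    · exact measureReal_le_one.trans hw1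
  intro v hv
  refine ⟨?_, heq v hv⟩
  have h0 : Q.real {v} ≤ 0 := by
    refine le_of_forall_pos_le_add fun ε hε => ?_
    -- A point of `(0, v)` within `ε` of `v`: the atom has mass at most `v - w ≤ ε`.
    set w := max (v / 2) (v - ε) with hw
    have hwv : w < v := max_lt (by linarith [hv.1]) (by linarith)
    have hw0 : 0 < w := lt_max_of_lt_left (by linarith [hv.1])
    have h1 : Q.real {v} ≤ Q.real (Set.Iic v \ Set.Iic w) := by
      refine measureReal_mono ?_
      rintro _ rfl
      exact ⟨Set.mem_Iic.2 le_rfl, not_le.2 hwv⟩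
    rw [measureReal_sdiff (Set.Iic_subset_Iic.2 hwv.le) measurableSet_Iic, heq v hv,
      heq w ⟨hw0, hwv.trans hv.2⟩] at h1
    have : v - ε ≤ w := le_max_right _ _
    linarith
  have h1 : Q.real {v} = 0 := le_antisymm h0 measureReal_nonneg
  exact (measureReal_eq_zero_iff).1 h1

end Distribution

/-- Convergence along every sequence `(a n, n)` with `a n → a₀` implies convergence along
`(a n, m n)` for every `m n → ∞`. -/
theorem tendsto_of_forall_seq {α β : Type*} [TopologicalSpace α] [TopologicalSpace β]
    {s : Set α} {a₀ : α} (ha₀ : a₀ ∈ s) {f : α → ℕ → β} {c : β}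
    (h : ∀ a : ℕ → α, (∀ n, a n ∈ s) → Tendsto a atTop (𝓝 a₀) →
      Tendsto (fun n => f (a n) n) atTop (𝓝 c))
    {m : ℕ → ℕ} (hm : Tendsto m atTop atTop) {a : ℕ → α} (ha : ∀ n, a n ∈ s)
    (ha' : Tendsto a atTop (𝓝 a₀)) : Tendsto (fun n => f (a n) (m n)) atTop (𝓝 c) := by
  refine tendsto_of_subseq_tendsto fun ns hns => ?_
  obtain ⟨ms, hms, hstrict⟩ := strictMono_subseq_of_tendsto_atTop (hm.comp hns)
  refine ⟨ms, ?_⟩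
  -- Along a further subsequence the sizes `κ k` are strictly increasing, so `a (ns (ms k))` can be
  -- placed at index `κ k` of a new sequence filled up with `a₀`, to which the hypothesis applies.
  set κ : ℕ → ℕ := (m ∘ ns) ∘ ms
  set b : ℕ → α := Function.extend κ (fun k => a (ns (ms k))) fun _ => a₀
  have hbκ : ∀ k, b (κ k) = a (ns (ms k)) := fun k => hstrict.injective.extend_apply _ _ _
  have hb : ∀ j, (∃ k, κ k = j) ∨ b j = a₀ := fun j => by
    by_cases hj : ∃ k, κ k = j
    · exact Or.inl hj
    · exact Or.inr (Function.extend_apply' _ _ _ hj)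
  have hbs : ∀ j, b j ∈ s := fun j => by
    rcases hb j with ⟨k, rfl⟩ | hj
    · rw [hbκ]; exact ha _
    · rw [hj]; exact ha₀
  have hbt : Tendsto b atTop (𝓝 a₀) := by
    intro U hU
    have h1 : Tendsto (fun k => a (ns (ms k))) atTop (𝓝 a₀) :=
      ha'.comp (hns.comp hms.tendsto_atTop)
    obtain ⟨K, hK⟩ := eventually_atTop.1 (h1.eventually hU)
    refine mem_atTop_sets.2 ⟨κ K, fun j hj => ?_⟩
    rcases hb j with ⟨k, rfl⟩ | hj'
    · rw [Set.mem_preimage, hbκ]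
      exact hK k (hstrict.le_iff_le.1 hj)
    · rw [Set.mem_preimage, hj']
      exact mem_of_mem_nhds hU
  refine ((h b hbs hbt).comp hstrict.tendsto_atTop).congr fun k => ?_
  simp only [Function.comp, hbκ]
  rfl

/-! ### The copula of the full-sample statistics -/

section Population

variable {𝒳 𝒲 : Type*} [MeasurableSpace 𝒳] [MeasurableSpace 𝒲] {L : ℕ}
  {PΩ : Measure 𝒲} {T : (n : ℕ) → (Fin n → 𝒳) × 𝒲 → Fin L → ℝ}

theorem measurable_apply (hT : ∀ n, Measurable (T n)) (n : ℕ) (l : Fin L) :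
    Measurable fun z => T n z l := (measurable_pi_apply l).comp (hT n)

variable [NeZero L]

theorem monotone_singleCDF (P : ProbabilityMeasure 𝒳) (n : ℕ) :
    Monotone (singleCDF PΩ T P n) := monotone_cdf _

theorem singleCDF_mem_Icc (P : ProbabilityMeasure 𝒳) (n : ℕ) (x : ℝ) :
    singleCDF PΩ T P n x ∈ Set.Icc (0 : ℝ) 1 := cdf_mem_Icc _ _

/-- The copula transform of a vector. -/
noncomputable def copulaMap (PΩ : Measure 𝒲) (T : (n : ℕ) → (Fin n → 𝒳) × 𝒲 → Fin L → ℝ)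
    (P : ProbabilityMeasure 𝒳) (n : ℕ) (t : Fin L → ℝ) : Fin L → ℝ :=
  fun l => singleCDF PΩ T P n (t l)

theorem measurable_copulaMap (P : ProbabilityMeasure 𝒳) (n : ℕ) :
    Measurable (copulaMap PΩ T P n) :=
  measurable_pi_lambda _ fun l =>
    (monotone_singleCDF P n).measurable.comp (measurable_pi_apply l)

theorem measurable_copulaVec (hT : ∀ n, Measurable (T n)) (P : ProbabilityMeasure 𝒳) (n : ℕ) :
    Measurable (copulaVec PΩ T P n) := (measurable_copulaMap P n).comp (hT n)

variable [IsProbabilityMeasure PΩ]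

/-- Exchangeability under the transposition of `0` and `l` makes the first distribution function
that of every coordinate. -/
theorem singleCDF_eq (hT : ∀ n, Measurable (T n)) {P : ProbabilityMeasure 𝒳}
    (hex : IsExchangeable PΩ T P) (n : ℕ) (l : Fin L) (x : ℝ) :
    singleCDF PΩ T P n x = (sampleLaw PΩ P n).real {z | T n z l ≤ x} := by
  have hmap : (sampleLaw PΩ P n).map (fun z => T n z 0) = (sampleLaw PΩ P n).map
      (fun z => T n z l) := by
    have h := hex n (Equiv.swap 0 l)
    have h1 := congrArg (fun ν => Measure.map (fun t : Fin L → ℝ => t 0) ν) h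
    rw [Measure.map_map (measurable_pi_apply _)
      (measurable_pi_lambda _ fun k => measurable_apply hT n _),
      Measure.map_map (measurable_pi_apply _) (hT n)] at h1
    simp only [Function.comp_def, Equiv.swap_apply_left] at h1
    exact h1.symm
  have : IsProbabilityMeasure ((sampleLaw PΩ P n).map (fun z => T n z l)) :=
    Measure.isProbabilityMeasure_map (measurable_apply hT n l).aemeasurable
  rw [singleCDF, hmap, cdf_eq_real, measureReal_def,
    Measure.map_apply (measurable_apply hT n l) measurableSet_Iic]
  rfl

/-- Convergence in distribution of the statistics to a law without atoms makes their distribution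
functions converge uniformly. -/
theorem eventually_abs_singleCDF_sub_le (hT : ∀ n, Measurable (T n)) {P : ProbabilityMeasure 𝒳}
    (hex : IsExchangeable PΩ T P) {F₀ : Measure ℝ} [IsProbabilityMeasure F₀]
    [NullSingletonClass F₀]
    (hpivot : TendstoInDistribution (fun (n : ℕ) z => T n z 0) atTop id (sampleLaw PΩ P) F₀)
    {ε : ℝ} (hε : 0 < ε) :
    ∀ᶠ n in atTop, ∀ x, |singleCDF PΩ T P n x - cdf F₀ x| ≤ ε := by
  obtain ⟨A, -, hA⟩ := exists_finset_forall_abs_sub_le (monotone_cdf F₀) (cdf_mem_Icc F₀)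
    (exists_cdf_eq F₀) (half_pos hε)
  have h1 : ∀ᶠ n in atTop, ∀ a ∈ A, |singleCDF PΩ T P n a - cdf F₀ a| ≤ ε / 2 := by
    rw [Finset.eventually_all]
    intro a _
    have h2 := tendsto_real_le_of_tendstoInDistribution hpivot (x := a) (measure_singleton a)
    rw [← cdf_eq_real] at h2
    filter_upwards [Metric.tendsto_nhds.1 h2 (ε / 2) (half_pos hε)] with n hn
    rw [singleCDF_eq hT hex n 0]
    exact hn.le
  filter_upwards [h1] with n hn x
  have := hA _ (monotone_singleCDF P n) (singleCDF_mem_Icc P n) (ε / 2) (half_pos hε).le hn x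
  linarith

/-- The coordinates of the copula vector are asymptotically uniform under the null. -/
theorem tendsto_real_copulaVec_le (hT : ∀ n, Measurable (T n)) {P : ProbabilityMeasure 𝒳}
    (hex : IsExchangeable PΩ T P) {F₀ : Measure ℝ} [IsProbabilityMeasure F₀]
    [NullSingletonClass F₀]
    (hpivot : TendstoInDistribution (fun (n : ℕ) z => T n z 0) atTop id (sampleLaw PΩ P) F₀)
    (l : Fin L) {v : ℝ} (hv : v ∈ Set.Ioo (0 : ℝ) 1) :
    Tendsto (fun n => (sampleLaw PΩ P n).real {z | copulaVec PΩ T P n z l ≤ v}) atTop (𝓝 v) := by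
  rw [Metric.tendsto_nhds]
  intro ε' hε'
  -- With `F₀ x₁ = v - ε` and `F₀ x₂ = v + 2 * ε`, uniform `ε`-closeness sandwiches `{F_n(T) ≤ v}`
  -- between `{T ≤ x₁}` and `{T ≤ x₂}`; the extra `ε` at `x₂` makes the comparison strict. The total
  -- error is at most `3 * ε < ε'`.
  obtain ⟨ε, hε, hε1⟩ : ∃ ε > 0, ε < min (ε' / 3) (min v ((1 - v) / 2)) :=
    exists_between (lt_min (by positivity) (lt_min hv.1 (by linarith [hv.2])))
  obtain ⟨ha, hb, hc⟩ : ε < ε' / 3 ∧ ε < v ∧ ε < (1 - v) / 2 := by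
    simpa only [lt_min_iff] using hε1
  obtain ⟨x₁, hx₁⟩ := exists_cdf_eq F₀ (v - ε) ⟨by linarith, by linarith [hv.2]⟩
  obtain ⟨x₂, hx₂⟩ := exists_cdf_eq F₀ (v + 2 * ε) ⟨by linarith, by linarith⟩
  filter_upwards [eventually_abs_singleCDF_sub_le hT hex hpivot hε] with n hn
  have h1 := abs_le.1 (hn x₁)
  have h2 := abs_le.1 (hn x₂)
  have hlow : singleCDF PΩ T P n x₁
      ≤ (sampleLaw PΩ P n).real {z | copulaVec PΩ T P n z l ≤ v} := by
    rw [singleCDF_eq hT hex n l]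
    refine measureReal_mono fun z hz => ?_
    have h3 := monotone_singleCDF (PΩ := PΩ) (T := T) P n (show T n z l ≤ x₁ from hz)
    show singleCDF PΩ T P n (T n z l) ≤ v
    linarith
  have hupp : (sampleLaw PΩ P n).real {z | copulaVec PΩ T P n z l ≤ v}
      ≤ singleCDF PΩ T P n x₂ := by
    rw [singleCDF_eq hT hex n l]
    refine measureReal_mono fun z hz => ?_
    have h3 : singleCDF PΩ T P n (T n z l) ≤ v := hz
    show T n z l ≤ x₂
    by_contra! hlt
    have h4 := monotone_cdf F₀ hlt.le
    have h5 := abs_le.1 (hn (T n z l))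
    linarith
  rw [Real.dist_eq, abs_lt]
  constructor <;> linarith

theorem integral_tailCount (hT : ∀ n, Measurable (T n)) (P : ProbabilityMeasure 𝒳) (n : ℕ)
    (δ : ℝ) :
    Integrable (fun z => tailCount δ (copulaVec PΩ T P n z)) (sampleLaw PΩ P n) ∧
    ∫ z, tailCount δ (copulaVec PΩ T P n z) ∂(sampleLaw PΩ P n)
      = ∑ l, ((sampleLaw PΩ P n).real {z | copulaVec PΩ T P n z l ≤ 2 * δ} + 1
        - (sampleLaw PΩ P n).real {z | copulaVec PΩ T P n z l ≤ 1 - 2 * δ}) := by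
  have hms : ∀ (l : Fin L) (v : ℝ), MeasurableSet {z | copulaVec PΩ T P n z l ≤ v} := fun l v =>
    measurableSet_le ((measurable_pi_apply l).comp (measurable_copulaVec hT P n)) measurable_const
  have hind : ∀ (l : Fin L) (v : ℝ) z,
      Set.indicator (Set.Iic v) (fun _ => (1 : ℝ)) (copulaVec PΩ T P n z l)
        = Set.indicator {z | copulaVec PΩ T P n z l ≤ v} (fun _ => (1 : ℝ)) z := fun l v z => by
    simp only [Set.indicator, Set.mem_Iic, Set.mem_ofPred_eq]
  have hint : ∀ (l : Fin L) (v : ℝ), Integrable (fun z =>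
      Set.indicator {z | copulaVec PΩ T P n z l ≤ v} (fun _ => (1 : ℝ)) z) (sampleLaw PΩ P n) :=
    fun l v => (integrable_const _).indicator (hms l v)
  have hint' : ∀ l : Fin L, Integrable (fun z =>
      Set.indicator {z | copulaVec PΩ T P n z l ≤ 2 * δ} (fun _ => (1 : ℝ)) z + 1
      - Set.indicator {z | copulaVec PΩ T P n z l ≤ 1 - 2 * δ} (fun _ => (1 : ℝ)) z)
      (sampleLaw PΩ P n) :=
    fun l => ((hint l _).add (integrable_const _)).sub (hint l _)
  unfold tailCount
  simp only [hind]
  refine ⟨integrable_finsetSum _ fun l _ => hint' l, ?_⟩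
  rw [integral_finsetSum _ fun l _ => hint' l]
  refine Finset.sum_congr rfl fun l _ => ?_
  have hval : ∀ v : ℝ, ∫ z, Set.indicator {z | copulaVec PΩ T P n z l ≤ v} (fun _ => (1 : ℝ)) z
      ∂(sampleLaw PΩ P n) = (sampleLaw PΩ P n).real {z | copulaVec PΩ T P n z l ≤ v} := fun v => by
    rw [integral_indicator (hms l v), setIntegral_const, smul_eq_mul, mul_one]
  have h1 := integral_add (hint l (2 * δ)) (integrable_const (μ := sampleLaw PΩ P n) (1 : ℝ))
  have h2 := integral_sub ((hint l (2 * δ)).add (integrable_const (μ := sampleLaw PΩ P n) (1 : ℝ)))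
    (hint l (1 - 2 * δ))
  simp only [Pi.add_apply] at h1 h2
  rw [h2, h1, hval, hval]
  simp

/-- The limit law of the aggregated statistic is nearly the truncated aggregation of the limit
copula. -/
theorem abs_integral_sub_integral_truncAgg_le (hT : ∀ n, Measurable (T n))
    {P : ProbabilityMeasure 𝒳} (hex : IsExchangeable PΩ T P) {F₀ : Measure ℝ}
    [IsProbabilityMeasure F₀] [NullSingletonClass F₀] (hreg : IsRegular (cdf F₀))
    (hpivot : TendstoInDistribution (fun (n : ℕ) z => T n z 0) atTop id (sampleLaw PΩ P) F₀)
    {S : (Fin L → ℝ) → ℝ} (hS : UniformContinuous S) {Q : Measure ℝ} [IsProbabilityMeasure Q]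
    (hQ : TendstoInDistribution (fun (n : ℕ) z => S (T n z)) atTop id (sampleLaw PΩ P) Q)
    {C : Measure (Fin L → ℝ)} [IsProbabilityMeasure C]
    (hC : TendstoInDistribution (copulaVec PΩ T P) atTop id (sampleLaw PΩ P) C)
    {φ : ℝ → ℝ} (hφ : UniformContinuous φ) (h01 : ∀ s, φ s ∈ Set.Icc (0 : ℝ) 1)
    {δ : ℝ} (hδ : 0 < δ) (hδ' : δ < 1 / 2) :
    |∫ s, φ s ∂Q - ∫ u, truncAgg (cdf F₀) S φ δ u ∂C| ≤ 4 * L * δ := by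
  set g := truncAgg (cdf F₀) S φ δ with hg
  have hguc : UniformContinuous g := uniformContinuous_truncAgg hreg hS hφ hδ hδ'.le
  have hg01 : ∀ u, g u ∈ Set.Icc (0 : ℝ) 1 := truncAgg_mem_Icc h01 δ
  refine le_of_forall_pos_le_add fun ε hε => ?_
  have hlim1 := tendsto_integral_of_tendstoInDistribution hQ hφ.continuous h01
  have hlim2 := tendsto_integral_of_tendstoInDistribution hC hguc.continuous hg01
  -- Asymptotic uniformity gives each coordinate tail mass `4δ`, whence the bound `4 * L * δ`.
  have htail : Tendsto (fun n => ∫ z, tailCount δ (copulaVec PΩ T P n z) ∂(sampleLaw PΩ P n))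
      atTop (𝓝 (∑ _l : Fin L, (2 * δ + 1 - (1 - 2 * δ)))) := by
    simp only [fun n => (integral_tailCount (PΩ := PΩ) hT P n δ).2]
    refine tendsto_finsetSum _ fun l _ => ?_
    exact ((tendsto_real_copulaVec_le hT hex hpivot l ⟨by linarith, by linarith⟩).add_const 1).sub
      (tendsto_real_copulaVec_le hT hex hpivot l ⟨by linarith, by linarith⟩)
  obtain ⟨η, hη, hmod⟩ := Metric.uniformContinuous_iff_le.1 hguc ε hε
  have hbound : ∀ᶠ n in atTop,
      |∫ z, φ (S (T n z)) ∂(sampleLaw PΩ P n) - ∫ z, g (copulaVec PΩ T P n z) ∂(sampleLaw PΩ P n)|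
        ≤ ε + ∫ z, tailCount δ (copulaVec PΩ T P n z) ∂(sampleLaw PΩ P n) := by
    filter_upwards [eventually_abs_singleCDF_sub_le hT hex hpivot (lt_min hη hδ)] with n hn
    have hi1 : Integrable (fun z => φ (S (T n z))) (sampleLaw PΩ P n) :=
      Integrable.of_mem_Icc 0 1
        ((hφ.continuous.comp hS.continuous).measurable.comp (hT n)).aemeasurable
        (ae_of_all _ fun z => h01 _)
    have hi2 : Integrable (fun z => g (copulaVec PΩ T P n z)) (sampleLaw PΩ P n) :=
      Integrable.of_mem_Icc 0 1
        (hguc.continuous.measurable.comp (measurable_copulaVec hT P n)).aemeasurable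
        (ae_of_all _ fun z => hg01 _)
    have hi3 := (integral_tailCount (PΩ := PΩ) hT P n δ).1
    rw [← integral_sub hi1 hi2]
    have h1 : ∫ z, (ε + tailCount δ (copulaVec PΩ T P n z)) ∂(sampleLaw PΩ P n)
        = ε + ∫ z, tailCount δ (copulaVec PΩ T P n z) ∂(sampleLaw PΩ P n) := by
      rw [integral_add (integrable_const _) hi3]; simp
    rw [← h1]
    refine abs_integral_le_integral_abs.trans
      (integral_mono (hi1.sub hi2).abs ((integrable_const _).add hi3) fun z => ?_)
    -- The approximation of the copula vector is `F₀(T)`, which `F₀⁻¹` inverts exactly in the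
    -- interior.
    have hru : ∀ l, |cdf F₀ (T n z l) - copulaVec PΩ T P n z l| ≤ min η δ := fun l => by
      rw [abs_sub_comm]; exact hn _
    refine abs_sub_truncAgg_le h01 hδ (min_le_right η δ) hε.le
      (r := fun l => cdf F₀ (T n z l)) hru ?_ fun l hl => hreg.quantile_apply hl
    rw [← Real.dist_eq]
    refine hmod ((dist_pi_le_iff hη.le).2 fun l => ?_)
    rw [Real.dist_eq]
    exact (hru l).trans (min_le_left _ _)
  have h1 := le_of_tendsto_of_tendsto (hlim1.sub hlim2).abs (htail.const_add ε) hbound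
  refine h1.trans (le_of_eq ?_)
  simp only [Finset.sum_const, Finset.card_univ, Fintype.card_fin, nsmul_eq_mul]
  ring

end Population

/-! ### Averages over rows -/

section RowMean

variable {ι : Type*} [Fintype ι] {L : ℕ}

theorem rowMean_indicator_eq_empCDF (U : ι → Fin L → ℝ) (v : ℝ) :
    rowMean U (fun u => (∑ l, Set.indicator (Set.Iic v) (fun _ => (1 : ℝ)) (u l)) / L)
      = empCDF (fun q : ι × Fin L => U q.1 q.2) v := by
  rw [rowMean, empCDF_eq_sum, Fintype.sum_prod_type, ← Finset.sum_div, div_div,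
    Fintype.card_prod, Fintype.card_fin]
  push_cast
  rw [mul_comm (L : ℝ)]

theorem rowMean_tailCount [NeZero L] [Nonempty ι] (U : ι → Fin L → ℝ) (δ : ℝ) :
    rowMean U (tailCount δ) = L * (empCDF (fun q : ι × Fin L => U q.1 q.2) (2 * δ) + 1
      - empCDF (fun q : ι × Fin L => U q.1 q.2) (1 - 2 * δ)) := by
  have hL : (L : ℝ) ≠ 0 := by exact_mod_cast NeZero.ne L
  have hι : (Fintype.card ι : ℝ) ≠ 0 := by exact_mod_cast Fintype.card_ne_zero
  rw [empCDF_eq_sum, empCDF_eq_sum, rowMean, Fintype.sum_prod_type, Fintype.sum_prod_type,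
    Fintype.card_prod, Fintype.card_fin]
  simp only [tailCount, Finset.sum_sub_distrib, Finset.sum_add_distrib, Finset.sum_const,
    Finset.card_univ, Fintype.card_fin, nsmul_eq_mul, Nat.cast_mul, mul_one]
  field_simp

theorem abs_rowMean_sub_le [Nonempty ι] {H H' : ι → Fin L → ℝ} {f g k : (Fin L → ℝ) → ℝ} {ε : ℝ}
    (h : ∀ b, |f (H b) - g (H' b)| ≤ ε + k (H' b)) :
    |rowMean H f - rowMean H' g| ≤ ε + rowMean H' k := by
  have hι : (0 : ℝ) < Fintype.card ι := by exact_mod_cast Fintype.card_pos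
  rw [rowMean, rowMean, rowMean, ← sub_div, ← Finset.sum_sub_distrib, abs_div, abs_of_pos hι,
    div_le_iff₀ hι, add_mul, div_mul_cancel₀ _ hι.ne']
  calc _ ≤ ∑ b, |f (H b) - g (H' b)| := Finset.abs_sum_le_sum_abs _ _
    _ ≤ ∑ b, (ε + k (H' b)) := Finset.sum_le_sum fun b _ => h b
    _ = _ := by simp [Finset.sum_add_distrib, mul_comm]

/-- If the copula transforms of the entries are nearly uniform, then averages over the
rank-transformed rows are close to truncated averages over the copula-transformed rows. -/
theorem abs_rowMean_rankTransform_sub_le [NeZero L] [Nonempty ι] {F F₀ : ℝ → ℝ} (hF : Monotone F)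
    (h01 : ∀ x, F x ∈ Set.Icc (0 : ℝ) 1) {S : (Fin L → ℝ) → ℝ} {φ : ℝ → ℝ}
    (hφ : ∀ s, φ s ∈ Set.Icc (0 : ℝ) 1) {δ η ε : ℝ} (hδ : 0 < δ)
    (hδ' : δ < 1 / 2) (hη : 0 ≤ η) (hηδ : 2 * η ≤ δ) (hε : 0 ≤ ε)
    (hmod : ∀ r u : Fin L → ℝ, (∀ l, |r l - u l| ≤ 2 * η) →
      |truncAgg F₀ S φ δ r - truncAgg F₀ S φ δ u| ≤ ε)
    (H : ι → Fin L → ℝ) (hcard : 1 / (2 * (Fintype.card ι : ℝ) * (L : ℝ)) ≤ η)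
    (hV : ∀ u, |empCDF (fun q : ι × Fin L => F (H q.1 q.2)) u - clampUnit u| ≤ η) :
    |rowMean (rankTransform F₀ H) (fun t => φ (S t))
      - rowMean (fun b l => F (H b l)) (truncAgg F₀ S φ δ)| ≤ ε + L * (4 * δ + 2 * η) := by
  have hN : 0 ≤ 1 / (2 * (Fintype.card ι : ℝ) * (L : ℝ)) := by positivity
  have h1 : |rowMean (rankTransform F₀ H) (fun t => φ (S t))
      - rowMean (fun b l => F (H b l)) (truncAgg F₀ S φ δ)|
      ≤ ε + rowMean (fun b l => F (H b l)) (tailCount δ) := by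
    refine abs_rowMean_sub_le fun b => ?_
    -- One `η` is for the rank against the copula transform, the other for the shift `1 / (2BL)`.
    have hru : ∀ l, |empCDF (fun q : ι × Fin L => H q.1 q.2) (H b l)
        - 1 / (2 * (Fintype.card ι : ℝ) * (L : ℝ)) - F (H b l)| ≤ 2 * η := fun l => by
      have h2 := abs_le.1 (abs_empCDF_sub_le hF h01 (fun q : ι × Fin L => H q.1 q.2) hV (b, l))
      rw [abs_le]
      constructor <;> linarith [h2.1, h2.2]
    exact abs_sub_truncAgg_le hφ hδ hηδ hε hru (hmod _ _ hru) fun l _ => rfl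
  refine h1.trans ?_
  rw [rowMean_tailCount]
  have h2 := abs_le.1 (hV (2 * δ))
  have h3 := abs_le.1 (hV (1 - 2 * δ))
  rw [clampUnit_of_mem ⟨by linarith, by linarith⟩] at h2 h3
  gcongr
  linarith

end RowMean

/-! ### Continuous approximation of half-line indicators -/

/-- The piecewise linear function that is one up to `t` and zero from `t + ε` on. -/
noncomputable def ramp (t ε s : ℝ) : ℝ := clampUnit (1 / ε * (t + ε - s))

theorem ramp_mem_Icc (t ε s : ℝ) : ramp t ε s ∈ Set.Icc (0 : ℝ) 1 := clampUnit_mem_Icc _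

theorem uniformContinuous_ramp (t ε : ℝ) : UniformContinuous (ramp t ε) := by
  have h1 : UniformContinuous clampUnit :=
    ((LipschitzWith.id.const_min 1).const_max 0).uniformContinuous
  exact h1.comp ((uniformContinuous_const_smul (1 / ε)).comp
    (uniformContinuous_const.sub uniformContinuous_id))

theorem indicator_le_ramp {t ε : ℝ} (hε : 0 < ε) (s : ℝ) :
    Set.indicator (Set.Iic t) (fun _ => (1 : ℝ)) s ≤ ramp t ε s := by
  by_cases hs : s ≤ t
  · rw [Set.indicator_of_mem (Set.mem_Iic.2 hs)]
    refine le_max_of_le_right (le_min le_rfl ?_)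
    rw [one_div, ← div_eq_inv_mul, le_div_iff₀ hε]
    linarith
  · rw [Set.indicator_of_notMem (by simpa using hs)]
    exact (ramp_mem_Icc t ε s).1

theorem ramp_le_indicator {t ε : ℝ} (hε : 0 < ε) (s : ℝ) :
    ramp t ε s ≤ Set.indicator (Set.Iic (t + ε)) (fun _ => (1 : ℝ)) s := by
  by_cases hs : s ≤ t + ε
  · rw [Set.indicator_of_mem (Set.mem_Iic.2 hs)]
    exact (ramp_mem_Icc t ε s).2
  · rw [Set.indicator_of_notMem (by simpa using hs)]
    refine max_le le_rfl (min_le_of_right_le ?_)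
    exact mul_nonpos_of_nonneg_of_nonpos (by positivity) (by linarith)

theorem integral_ramp_mem_Icc (Q : Measure ℝ) [IsProbabilityMeasure Q] {t ε : ℝ} (hε : 0 < ε) :
    ∫ s, ramp t ε s ∂Q ∈ Set.Icc (cdf Q t) (cdf Q (t + ε)) := by
  have hi : Integrable (ramp t ε) Q := Integrable.of_mem_Icc 0 1
    (uniformContinuous_ramp t ε).continuous.measurable.aemeasurable
    (ae_of_all _ fun s => ramp_mem_Icc t ε s)
  have hind : ∀ x : ℝ, Integrable (Set.indicator (Set.Iic x) fun _ => (1 : ℝ)) Q ∧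
      ∫ s, Set.indicator (Set.Iic x) (fun _ => (1 : ℝ)) s ∂Q = cdf Q x := fun x => by
    refine ⟨(integrable_const _).indicator measurableSet_Iic, ?_⟩
    rw [integral_indicator measurableSet_Iic, setIntegral_const, smul_eq_mul, mul_one,
      cdf_eq_real]
  rw [← (hind t).2, ← (hind (t + ε)).2]
  exact ⟨integral_mono (hind t).1 hi fun s => indicator_le_ramp hε s,
    integral_mono hi (hind _).1 fun s => ramp_le_indicator hε s⟩

theorem empCDF_le_rowMean_ramp {ι : Type*} [Fintype ι] {L : ℕ} (H : ι → Fin L → ℝ)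
    (S : (Fin L → ℝ) → ℝ) {t ε : ℝ} (hε : 0 < ε) :
    empCDF (fun b => S (H b)) t ≤ rowMean H (fun u => ramp t ε (S u)) := by
  rw [empCDF_eq_sum, rowMean]
  gcongr
  exact indicator_le_ramp hε _

theorem rowMean_ramp_le_empCDF {ι : Type*} [Fintype ι] {L : ℕ} (H : ι → Fin L → ℝ)
    (S : (Fin L → ℝ) → ℝ) {t ε : ℝ} (hε : 0 < ε) :
    rowMean H (fun u => ramp t ε (S u)) ≤ empCDF (fun b => S (H b)) (t + ε) := by
  rw [empCDF_eq_sum, rowMean]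
  gcongr
  exact ramp_le_indicator hε _

/-! ### Consistency of rank-transformed subsampling -/

section Subsampling

variable {𝒳 𝒲 : Type*} [MeasurableSpace 𝒳] [MeasurableSpace 𝒲] {L : ℕ} [NeZero L]
  {PΩ : Measure 𝒲} [IsProbabilityMeasure PΩ] {T : (n : ℕ) → (Fin n → 𝒳) × 𝒲 → Fin L → ℝ}
  {J : ℕ} {m : ℕ → ℕ} {P : ℕ → ProbabilityMeasure 𝒳}

theorem card_subIdx (n m J : ℕ) : Fintype.card (SubIdx n m J) = J * (n / m) := by simp

/-- The copula transforms of the entries of the subsample matrix are nearly uniform. -/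
theorem eventually_abs_empCDF_copula_sub_le (hJ : 0 < J)
    (hmn : Tendsto (fun n => n / m n) atTop atTop) (hT : ∀ n, Measurable (T n))
    (hmarg : ∀ l, ∀ v ∈ Set.Ioo (0 : ℝ) 1, Tendsto (fun n => (sampleLaw PΩ (P n) (m n)).real
      {z | copulaVec PΩ T (P n) (m n) z l ≤ v}) atTop (𝓝 v)) {η : ℝ} (hη : 0 < η) :
    ∀ᶠ x : Σ n, Draw 𝒳 𝒲 n (m n) J in whp fun n => drawLaw PΩ (P n) n (m n) J,
      ∀ u, |empCDF (fun q : SubIdx x.1 (m x.1) J × Fin L =>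
        singleCDF PΩ T (P x.1) (m x.1) (subStats T x.2 q.1 q.2)) u - clampUnit u| ≤ η := by
  have hL : (0 : ℝ) < L := by exact_mod_cast NeZero.pos L
  have hpt : ∀ v ∈ Set.Ioo (0 : ℝ) 1, Tendsto (fun x : Σ n, Draw 𝒳 𝒲 n (m n) J =>
      empCDF (fun q : SubIdx x.1 (m x.1) J × Fin L =>
        singleCDF PΩ T (P x.1) (m x.1) (subStats T x.2 q.1 q.2)) v)
      (whp fun n => drawLaw PΩ (P n) n (m n) J) (𝓝 v) := by
    intro v hv
    -- The fraction of coordinates at most `v`: its row average is the pooled empirical distribution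
    -- function, and its expectation involves only the marginals, not the dependence within a row.
    set g : (Fin L → ℝ) → ℝ := fun u =>
      (∑ l, Set.indicator (Set.Iic v) (fun _ => (1 : ℝ)) (u l)) / L with hg
    have hgm : Measurable g := by
      refine Measurable.div_const (Finset.measurable_fun_sum _ fun l _ => ?_) _
      exact (measurable_const.indicator measurableSet_Iic).comp (measurable_pi_apply l)
    have hg01 : ∀ u, g u ∈ Set.Icc (0 : ℝ) 1 := fun u => by
      refine ⟨div_nonneg (Finset.sum_nonneg fun l _ =>
        Set.indicator_nonneg (fun _ _ => zero_le_one) _) hL.le, ?_⟩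
      rw [hg, div_le_one hL]
      calc _ ≤ ∑ _l : Fin L, (1 : ℝ) := Finset.sum_le_sum fun l _ =>
            Set.indicator_le_self' (f := fun _ => (1 : ℝ)) (fun _ _ => zero_le_one) _
        _ = L := by simp
    have hmean : Tendsto (fun n => ∫ z, g (copulaMap PΩ T (P n) (m n) (T (m n) z))
        ∂(sampleLaw PΩ (P n) (m n))) atTop (𝓝 v) := by
      have h1 : Tendsto (fun n => (∑ l, (sampleLaw PΩ (P n) (m n)).real
          {z | copulaVec PΩ T (P n) (m n) z l ≤ v}) / L) atTop (𝓝 ((∑ _l : Fin L, v) / L)) :=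
        (tendsto_finsetSum _ fun l _ => hmarg l v hv).div_const _
      have h2 : (∑ _l : Fin L, v) / L = v := by
        simp only [Finset.sum_const, Finset.card_univ, Fintype.card_fin, nsmul_eq_mul]
        field_simp
      rw [h2] at h1
      refine h1.congr fun n => ?_
      have hms : ∀ l : Fin L, MeasurableSet {z | copulaVec PΩ T (P n) (m n) z l ≤ v} := fun l =>
        measurableSet_le ((measurable_pi_apply l).comp (measurable_copulaVec hT (P n) (m n)))
          measurable_const
      have h3 : ∀ z, g (copulaMap PΩ T (P n) (m n) (T (m n) z)) = (∑ l, Set.indicator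
          {z | copulaVec PΩ T (P n) (m n) z l ≤ v} (fun _ => (1 : ℝ)) z) / L := fun z => rfl
      simp only [h3]
      rw [integral_div, integral_finsetSum _ fun l _ => (integrable_const _).indicator (hms l)]
      congr 1
      refine Finset.sum_congr rfl fun l _ => ?_
      rw [integral_indicator (hms l), setIntegral_const, smul_eq_mul, mul_one]
    refine (tendsto_rowMean PΩ hJ hmn hT P
      (g := fun n t => g (copulaMap PΩ T (P n) (m n) t))
      (fun n => hgm.comp (measurable_copulaMap (P n) (m n))) (fun n t => hg01 _) hmean).congr
      fun x => ?_
    exact rowMean_indicator_eq_empCDF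
      (fun b => copulaMap PΩ T (P x.1) (m x.1) (subStats T x.2 b)) v
  obtain ⟨A, hA01, hA⟩ := exists_finset_forall_abs_sub_le monotone_clampUnit clampUnit_mem_Icc
    exists_clampUnit_eq (half_pos hη)
  have h1 : ∀ᶠ x : Σ n, Draw 𝒳 𝒲 n (m n) J in whp fun n => drawLaw PΩ (P n) n (m n) J,
      ∀ a ∈ A, |empCDF (fun q : SubIdx x.1 (m x.1) J × Fin L =>
        singleCDF PΩ T (P x.1) (m x.1) (subStats T x.2 q.1 q.2)) a - clampUnit a| ≤ η / 2 := by
    rw [Finset.eventually_all]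
    intro a ha
    have h01 := mem_Ioo_of_clampUnit_mem (hA01 a ha)
    filter_upwards [Metric.tendsto_nhds.1 (hpt a h01) (η / 2) (half_pos hη)] with x hx
    rw [clampUnit_of_mem ⟨h01.1.le, h01.2.le⟩]
    exact hx.le
  filter_upwards [h1] with x hx u
  have := hA _ (monotone_empCDF _) (empCDF_mem_Icc _) (η / 2) (half_pos hη).le hx u
  linarith

variable {F₀ : ℝ → ℝ} {S : (Fin L → ℝ) → ℝ} {Q : Measure ℝ} {C : Measure (Fin L → ℝ)}
  [IsProbabilityMeasure C]

/-- Averages over the rank-transformed rows converge to expectations under the limit law. -/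
theorem tendsto_rowMean_rankTransform (hJ : 0 < J)
    (hmn : Tendsto (fun n => n / m n) atTop atTop) (hT : ∀ n, Measurable (T n))
    (hmarg : ∀ l, ∀ v ∈ Set.Ioo (0 : ℝ) 1, Tendsto (fun n => (sampleLaw PΩ (P n) (m n)).real
      {z | copulaVec PΩ T (P n) (m n) z l ≤ v}) atTop (𝓝 v))
    (hC : TendstoInDistribution (fun n => copulaVec PΩ T (P n) (m n)) atTop id
      (fun n => sampleLaw PΩ (P n) (m n)) C)
    (hF₀ : IsRegular F₀) (hS : UniformContinuous S) {φ : ℝ → ℝ} (hφ : UniformContinuous φ)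
    (h01 : ∀ s, φ s ∈ Set.Icc (0 : ℝ) 1)
    (hQ : ∀ δ, 0 < δ → δ < 1 / 2 →
      |∫ s, φ s ∂Q - ∫ u, truncAgg F₀ S φ δ u ∂C| ≤ 4 * L * δ) :
    Tendsto (fun x : Σ n, Draw 𝒳 𝒲 n (m n) J =>
      rowMean (rankTransform F₀ (subStats T x.2)) fun t => φ (S t))
      (whp fun n => drawLaw PΩ (P n) n (m n) J) (𝓝 (∫ s, φ s ∂Q)) := by
  rw [Metric.tendsto_nhds]
  intro ε hε
  have hL : (1 : ℝ) ≤ L := by exact_mod_cast NeZero.pos L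
  -- The errors add up to less than `ε`: `ε / 8 + 5Lδ` from ranks and truncation, `ε / 8` from the
  -- law of large numbers, and `4Lδ` from the limit law.
  obtain ⟨δ, hδ, hδ'⟩ : ∃ δ > 0, δ < min (1 / 2) (ε / (32 * L)) :=
    exists_between (lt_min (by norm_num) (by positivity))
  obtain ⟨hδ1, hδ2⟩ := lt_min_iff.1 hδ'
  rw [lt_div_iff₀ (by positivity)] at hδ2
  set g := truncAgg F₀ S φ δ with hg
  have hguc : UniformContinuous g := uniformContinuous_truncAgg hF₀ hS hφ hδ hδ1.le
  obtain ⟨η₀, hη₀, hmod⟩ := Metric.uniformContinuous_iff_le.1 hguc (ε / 8) (by positivity)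
  set η := min (η₀ / 2) (δ / 2) with hη
  have hηpos : 0 < η := lt_min (by positivity) (by positivity)
  have hη1 : 2 * η ≤ η₀ := by linarith [min_le_left (η₀ / 2) (δ / 2)]
  have hη2 : 2 * η ≤ δ := by linarith [min_le_right (η₀ / 2) (δ / 2)]
  -- Enough rows for the shift `1 / (2BL)` to be at most `η`.
  have hcard : ∀ᶠ x : Σ n, Draw 𝒳 𝒲 n (m n) J in whp fun n => drawLaw PΩ (P n) n (m n) J,
      0 < x.1 / m x.1 ∧ 1 / η ≤ ((x.1 / m x.1 : ℕ) : ℝ) :=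
    eventually_whp_of_eventually (p := fun n => 0 < n / m n ∧ 1 / η ≤ ((n / m n : ℕ) : ℝ))
      ((hmn.eventually_gt_atTop 0).and
        ((tendsto_natCast_atTop_atTop.comp hmn).eventually_ge_atTop (1 / η)))
  have hmean := tendsto_integral_of_tendstoInDistribution hC hguc.continuous
    (truncAgg_mem_Icc h01 δ)
  have hlln := tendsto_rowMean PΩ hJ hmn hT P (g := fun n t => g (copulaMap PΩ T (P n) (m n) t))
    (fun n => hguc.continuous.measurable.comp (measurable_copulaMap (P n) (m n)))
    (fun n t => truncAgg_mem_Icc h01 δ _) hmean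
  filter_upwards [hcard, Metric.tendsto_nhds.1 hlln (ε / 8) (by positivity),
    eventually_abs_empCDF_copula_sub_le hJ hmn hT hmarg hηpos] with x hx1 hx2 hx3
  have hJ' : (1 : ℝ) ≤ J := by exact_mod_cast hJ
  have : Nonempty (SubIdx x.1 (m x.1) J) := ⟨(⟨0, hJ⟩, ⟨0, hx1.1⟩)⟩
  have h1 := abs_rowMean_rankTransform_sub_le (F₀ := F₀) (monotone_singleCDF (P x.1) (m x.1))
    (singleCDF_mem_Icc (P x.1) (m x.1)) (S := S) h01 hδ hδ1 hηpos.le hη2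
    (show 0 ≤ ε / 8 by positivity) (fun r u hru => by
      rw [← Real.dist_eq]
      refine hmod ((dist_pi_le_iff hη₀.le).2 fun l => ?_)
      rw [Real.dist_eq]
      exact (hru l).trans hη1) (subStats T x.2) (by
      rw [card_subIdx]
      push_cast
      rw [div_le_iff₀ (by have := hx1.1; positivity)]
      have h2 : 1 ≤ η * ((x.1 / m x.1 : ℕ) : ℝ) := by
        have := hx1.2
        rw [div_le_iff₀ hηpos] at this
        linarith
      have h3 : (1 : ℝ) ≤ 2 * J * L := by nlinarith
      calc (1 : ℝ) = 1 * 1 := by ring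
        _ ≤ (η * ((x.1 / m x.1 : ℕ) : ℝ)) * (2 * J * L) :=
          mul_le_mul h2 h3 zero_le_one (by linarith)
        _ = _ := by ring) hx3
  have h2 := hQ δ hδ hδ1
  rw [Real.dist_eq] at hx2 ⊢
  have h3 : rowMean (subStats T x.2) (fun t => g (copulaMap PΩ T (P x.1) (m x.1) t))
      = rowMean (fun b l => singleCDF PΩ T (P x.1) (m x.1) (subStats T x.2 b l)) g := rfl
  rw [h3] at hx2
  have h4 : (L : ℝ) * (4 * δ + 2 * η) ≤ L * (5 * δ) := by gcongr; linarith
  have h5 := abs_le.1 h1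
  have h6 := abs_lt.1 hx2
  have h7 := abs_le.1 h2
  rw [abs_lt]
  constructor <;> linarith

end Subsampling

/-- The rank-transformed subsampling distribution function is uniformly consistent. -/
theorem eventually_abs_rankSubCDF_sub_le {𝒳 𝒲 : Type*} [MeasurableSpace 𝒳]
    [MeasurableSpace 𝒲] {L : ℕ} {PΩ : Measure 𝒲} {T : (n : ℕ) → (Fin n → 𝒳) × 𝒲 → Fin L → ℝ}
    {J : ℕ} {m : ℕ → ℕ} {P : ℕ → ProbabilityMeasure 𝒳} {F₀ : ℝ → ℝ} {S : (Fin L → ℝ) → ℝ}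
    {Q : Measure ℝ} [IsProbabilityMeasure Q] [NullSingletonClass Q]
    (h : ∀ t, ∀ ε > 0, Tendsto (fun x : Σ n, Draw 𝒳 𝒲 n (m n) J =>
      rowMean (rankTransform F₀ (subStats T x.2)) fun u => ramp t ε (S u))
      (whp fun n => drawLaw PΩ (P n) n (m n) J) (𝓝 (∫ s, ramp t ε s ∂Q))) {η : ℝ} (hη : 0 < η) :
    ∀ᶠ x : Σ n, Draw 𝒳 𝒲 n (m n) J in whp fun n => drawLaw PΩ (P n) n (m n) J,
      ∀ t, |rankSubCDF F₀ S T x.2 t - cdf Q t| ≤ η := by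
  obtain ⟨A, -, hA⟩ := exists_finset_forall_abs_sub_le (monotone_cdf Q) (cdf_mem_Icc Q)
    (exists_cdf_eq Q) (half_pos hη)
  have hcont : Continuous (cdf Q) := continuous_cdf Q
  have h1 : ∀ᶠ x : Σ n, Draw 𝒳 𝒲 n (m n) J in whp fun n => drawLaw PΩ (P n) n (m n) J,
      ∀ a ∈ A, |rankSubCDF F₀ S T x.2 a - cdf Q a| ≤ η / 2 := by
    rw [Finset.eventually_all]
    intro a _
    obtain ⟨ρ, hρ, hρ'⟩ := Metric.continuousAt_iff.1 (hcont.continuousAt (x := a)) (η / 4)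
      (by positivity)
    -- Ramps of width `ρ / 2` starting at `a - ρ / 2` and at `a` bracket the indicator of `(-∞, a]`,
    -- and their integrals are within `η / 4` of `cdf Q a`.
    have hε : 0 < ρ / 2 := half_pos hρ
    have hup := hρ' (x := a + ρ / 2) (by simp [abs_of_pos hρ, hρ])
    have hdown := hρ' (x := a - ρ / 2) (by simp [abs_of_pos hρ, hρ])
    rw [Real.dist_eq, abs_lt] at hup hdown
    filter_upwards [Metric.tendsto_nhds.1 (h a (ρ / 2) hε) (η / 4) (by positivity),
      Metric.tendsto_nhds.1 (h (a - ρ / 2) (ρ / 2) hε) (η / 4) (by positivity)] with x hx1 hx2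
    rw [Real.dist_eq, abs_lt] at hx1 hx2
    have h2 := empCDF_le_rowMean_ramp (rankTransform F₀ (subStats T x.2)) S (t := a) hε
    have h3 := rowMean_ramp_le_empCDF (rankTransform F₀ (subStats T x.2)) S
      (t := a - ρ / 2) hε
    rw [sub_add_cancel] at h3
    have h4 := integral_ramp_mem_Icc Q (t := a) hε
    have h5 := integral_ramp_mem_Icc Q (t := a - ρ / 2) hε
    unfold rankSubCDF
    rw [abs_le]
    constructor <;> linarith [h4.2, h5.1]
  filter_upwards [h1] with x hx t
  have := hA _ (monotone_empCDF _) (empCDF_mem_Icc _) (η / 2) (half_pos hη).le hx t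
  unfold rankSubCDF
  linarith


/-! ### Critical values and power -/

/-- The mean over the levels of the increments of a monotone function telescopes. -/
theorem lintegral_monotone_shift_sub_le {k : ℝ → ℝ} (hk : Monotone k)
    (h01 : ∀ x, k x ∈ Set.Icc (0 : ℝ) 1) {η : ℝ} (hη : 0 ≤ η) :
    ∫⁻ α in Set.Ioo (0 : ℝ) 1, ENNReal.ofReal (k (α + η) - k (α - η))
      ≤ ENNReal.ofReal (2 * η) := by
  have hi : ∀ a b : ℝ, IntervalIntegrable k volume a b := fun _ _ => hk.intervalIntegrable
  have hp : IntervalIntegrable (fun α => k (α + η)) volume 0 1 :=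
    Monotone.intervalIntegrable fun _ _ h => hk (by linarith)
  have hm : IntervalIntegrable (fun α => k (α - η)) volume 0 1 :=
    Monotone.intervalIntegrable fun _ _ h => hk (by linarith)
  have hint := (hp.sub hm)
  rw [intervalIntegrable_iff_integrableOn_Ioo_of_le zero_le_one] at hint
  rw [← ofReal_integral_eq_lintegral_ofReal hint
    (ae_of_all _ fun α => sub_nonneg.2 (hk (by linarith)))]
  refine ENNReal.ofReal_le_ofReal ?_
  rw [← integral_Ioc_eq_integral_Ioo, ← intervalIntegral.integral_of_le zero_le_one]
  rw [intervalIntegral.integral_sub hp hm, intervalIntegral.integral_comp_add_right,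
    intervalIntegral.integral_comp_sub_right]
  -- The integral from `η` to `1 - η` cancels. What remains is at most the integral of `k` from `1 -
  -- η` to `1 + η`, minus a nonnegative one around 0.
  have e1 := intervalIntegral.integral_add_adjacent_intervals (hi (0 + η) (1 - η))
    (hi (1 - η) (1 + η))
  have e2 := intervalIntegral.integral_add_adjacent_intervals (hi (0 - η) (0 + η))
    (hi (0 + η) (1 - η))
  have e3 : ∫ x in (1 - η)..(1 + η), k x ≤ ∫ _x in (1 - η)..(1 + η), (1 : ℝ) :=
    intervalIntegral.integral_mono_on (by linarith) (hi _ _) intervalIntegrable_const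
      fun x _ => (h01 x).2
  have e4 : 0 ≤ ∫ x in (0 - η)..(0 + η), k x :=
    intervalIntegral.integral_nonneg (by linarith) fun x _ => (h01 x).1
  simp only [intervalIntegral.integral_const, smul_eq_mul, mul_one] at e3
  linarith

theorem abs_measureReal_sub_le {Ω : Type*} [MeasurableSpace Ω] (μ : Measure Ω) [IsFiniteMeasure μ]
    {A B D : Set Ω} (h1 : A ⊆ B ∪ D) (h2 : B ⊆ A ∪ D) : |μ.real A - μ.real B| ≤ μ.real D := by
  have h3 := (measureReal_mono (μ := μ) h1).trans (measureReal_union_le _ _)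
  have h4 := (measureReal_mono (μ := μ) h2).trans (measureReal_union_le _ _)
  rw [abs_le]
  constructor <;> linarith

section Power

variable {𝒳 𝒲 : Type*} [MeasurableSpace 𝒳] [MeasurableSpace 𝒲] {L : ℕ}
  {PΩ : Measure 𝒲} {T : (n : ℕ) → (Fin n → 𝒳) × 𝒲 → Fin L → ℝ}
  {J : ℕ} {m : ℕ → ℕ} {P : ℕ → ProbabilityMeasure 𝒳} {F₀ : ℝ → ℝ} {S : (Fin L → ℝ) → ℝ}
  {Q : Measure ℝ}

/-- The critical value converges in probability. -/
theorem tendsto_critValue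
    (hunif : ∀ η > 0, ∀ᶠ x : Σ n, Draw 𝒳 𝒲 n (m n) J in whp fun n => drawLaw PΩ (P n) n (m n) J,
      ∀ t, |rankSubCDF F₀ S T x.2 t - cdf Q t| ≤ η)
    {α : ℝ} (hα : α ∈ Set.Ioo (0 : ℝ) 1) (hc : ContinuousAt (quantile (cdf Q)) (1 - α))
    {ε : ℝ} (hε : 0 < ε) :
    Tendsto (fun n => drawLaw PΩ (P n) n (m n) J
      {d | ε ≤ |critValue F₀ S T α d - quantile (cdf Q) (1 - α)|}) atTop (𝓝 0) := by
  set p := 1 - α with hp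
  have hp0 : 0 < p := by linarith [hα.2]
  have hp1 : p < 1 := by linarith [hα.1]
  set q := quantile (cdf Q) p with hq
  have hlow : cdf Q (q - ε / 2) < p := by
    by_contra! h
    have := quantile_cdf_le Q hp0 h
    linarith
  -- Continuity of the quantile function excludes a flat piece at level `p` to the right of `q`:
  -- some level `p' > p` has its quantile below `q + ε / 2`.
  have hupp : p < cdf Q (q + ε / 2) := by
    obtain ⟨ρ, hρ, hρ'⟩ := Metric.continuousAt_iff.1 hc (ε / 2) (half_pos hε)
    obtain ⟨p', hpp', hp'⟩ := exists_between (lt_min hp1 (show p < p + ρ by linarith))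
    obtain ⟨h1, h2⟩ := lt_min_iff.1 hp'
    have h3 := hρ' (x := p') (by rw [Real.dist_eq, abs_of_pos] <;> linarith)
    rw [Real.dist_eq, abs_lt] at h3
    refine hpp'.trans_le ?_
    by_contra! h
    have := le_quantile_cdf Q h1 h
    linarith [h3.2]
  obtain ⟨η, hη, hη'⟩ := exists_between (lt_min (sub_pos.2 hlow) (sub_pos.2 hupp))
  obtain ⟨h1, h2⟩ := lt_min_iff.1 hη'
  have key : ∀ᶠ x : Σ n, Draw 𝒳 𝒲 n (m n) J in whp fun n => drawLaw PΩ (P n) n (m n) J,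
      |critValue F₀ S T α x.2 - q| < ε := by
    filter_upwards [hunif η hη] with x hx
    have h3 := abs_le.1 (hx (q - ε / 2))
    have h4 := abs_le.1 (hx (q + ε / 2))
    have h5 : rankSubCDF F₀ S T x.2 (q - ε / 2) < p := by linarith
    have h6 : p ≤ rankSubCDF F₀ S T x.2 (q + ε / 2) := by linarith
    have h7 : quantile (rankSubCDF F₀ S T x.2) p ≤ q + ε / 2 :=
      quantile_le (bddBelow_of_lt (monotone_empCDF _) ⟨_, h5⟩) h6
    have h8 : q - ε / 2 ≤ quantile (rankSubCDF F₀ S T x.2) p :=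
      le_quantile (monotone_empCDF _) ⟨_, h6⟩ h5
    rw [critValue, ← hp, abs_lt]
    constructor <;> linarith
  rw [eventually_whp] at key
  simpa only [not_lt] using key

variable [IsProbabilityMeasure PΩ]

theorem sampleLaw_real_eq (P : ProbabilityMeasure 𝒳) (n m J : ℕ) {s : Set ((Fin n → 𝒳) × 𝒲)}
    (hs : MeasurableSet s) : (sampleLaw PΩ P n).real s
      = (drawLaw PΩ P n m J).real {d | d.1 ∈ s} := by
  have h : MeasurePreserving Prod.fst (drawLaw PΩ P n m J) (sampleLaw PΩ P n) :=
    measurePreserving_fst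
  rw [measureReal_def, measureReal_def, ← h.measure_preimage hs.nullMeasurableSet]
  rfl

/-- The power of the oracle test as a function of `p = 1 - α`, extended by `1` below `0` and by
`0` above `1`. -/
noncomputable def extPower (PΩ : Measure 𝒲) (Q : Measure ℝ) (S : (Fin L → ℝ) → ℝ)
    (T : (n : ℕ) → (Fin n → 𝒳) × 𝒲 → Fin L → ℝ) (P : ProbabilityMeasure 𝒳) (n : ℕ) (p : ℝ) : ℝ :=
  if p ≤ 0 then 1 else if 1 ≤ p then 0 else
    (sampleLaw PΩ P n).real {z | quantile (cdf Q) p < S (T n z)}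

theorem extPower_mem_Icc (P : ProbabilityMeasure 𝒳) (n : ℕ) (p : ℝ) :
    extPower PΩ Q S T P n p ∈ Set.Icc (0 : ℝ) 1 := by
  unfold extPower
  split_ifs
  · exact ⟨zero_le_one, le_rfl⟩
  · exact ⟨le_rfl, zero_le_one⟩
  · exact ⟨measureReal_nonneg, measureReal_le_one⟩

theorem antitone_extPower (P : ProbabilityMeasure 𝒳) (n : ℕ) :
    Antitone (extPower PΩ Q S T P n) := by
  intro p p' hpp
  have h1 := (extPower_mem_Icc (PΩ := PΩ) (Q := Q) (S := S) (T := T) P n p).1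
  have h2 := (extPower_mem_Icc (PΩ := PΩ) (Q := Q) (S := S) (T := T) P n p').2
  by_cases hp0 : p ≤ 0
  · rwa [show extPower PΩ Q S T P n p = 1 from if_pos hp0]
  have hp0' : ¬ p' ≤ 0 := fun h => hp0 (hpp.trans h)
  by_cases hp1 : 1 ≤ p'
  · rwa [show extPower PΩ Q S T P n p' = 0 by rw [extPower, if_neg hp0', if_pos hp1]]
  have hp1' : ¬ 1 ≤ p := fun h => hp1 (h.trans hpp)
  rw [extPower, extPower, if_neg hp0, if_neg hp0', if_neg hp1, if_neg hp1']
  refine measureReal_mono fun z hz => ?_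
  exact lt_of_le_of_lt (monotoneOn_quantile_cdf Q ⟨not_le.1 hp0, not_le.1 hp1'⟩
    ⟨not_le.1 hp0', not_le.1 hp1⟩ hpp) hz

/-- Uniform closeness of the rank-transformed subsampling distribution function bounds the
difference in power between the test and the oracle test. -/
theorem abs_testPower_sub_oraclePower_le (hT : ∀ n, Measurable (T n)) (hS : Measurable S)
    (P : ProbabilityMeasure 𝒳) {n m : ℕ} (hJ : 0 < J) (hnm : 0 < n / m) {η : ℝ} (hη : 0 ≤ η)
    {α : ℝ} (hα : α ∈ Set.Ioo (0 : ℝ) 1) :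
    |testPower PΩ F₀ S T P n m J α - oraclePower PΩ Q S T P n α|
      ≤ (drawLaw PΩ P n m J).real
          {d | ¬ ∀ t, |rankSubCDF F₀ S T d t - cdf Q t| ≤ η}
        + (extPower PΩ Q S T P n (1 - α - η) - extPower PΩ Q S T P n (1 - α + η)) := by
  have : Nonempty (SubIdx n m J) := ⟨(⟨0, hJ⟩, ⟨0, hnm⟩)⟩
  set p := 1 - α with hp
  have hp0 : 0 < p := by linarith [hα.2]
  have hp1 : p < 1 := by linarith [hα.1]
  set D : Set (Draw 𝒳 𝒲 n m J) := {d | ¬ ∀ t, |rankSubCDF F₀ S T d t - cdf Q t| ≤ η} with hD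
  have hor : oraclePower PΩ Q S T P n α = extPower PΩ Q S T P n p := by
    rw [extPower, if_neg (not_le.2 hp0), if_neg (not_le.2 hp1)]; rfl
  have hms : ∀ x, MeasurableSet {z | x < S (T n z)} := fun x =>
    measurableSet_lt measurable_const (hS.comp (hT n))
  have hlow := antitone_extPower (PΩ := PΩ) (Q := Q) (S := S) (T := T) P n
    (show p - η ≤ p by linarith)
  have hupp := antitone_extPower (PΩ := PΩ) (Q := Q) (S := S) (T := T) P n
    (show p ≤ p + η by linarith)
  -- Off `D`, `p ≤ G̃(x)` implies `p - η ≤ G(x)`, so the critical value is at least the oracle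
  -- quantile at `p - η`. When `p - η ≤ 0` the value 1 of the extension makes the bound trivial. The
  -- lower bound is symmetric.
  have hub : testPower PΩ F₀ S T P n m J α
      ≤ (drawLaw PΩ P n m J).real D + extPower PΩ Q S T P n (p - η) := by
    by_cases h0 : p - η ≤ 0
    · rw [extPower, if_pos h0]
      have h1 : testPower PΩ F₀ S T P n m J α ≤ 1 := measureReal_le_one
      have h2 : 0 ≤ (drawLaw PΩ P n m J).real D := measureReal_nonneg
      linarith
    · rw [extPower, if_neg h0, if_neg (by linarith), sampleLaw_real_eq P n m J (hms _)]
      refine (measureReal_mono (fun d hd => ?_)).trans (measureReal_union_le _ _)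
      by_cases hdD : d ∈ D
      · exact Or.inl hdD
      · refine Or.inr (lt_of_le_of_lt ?_ (show critValue F₀ S T α d < S (T n d.1) from hd))
        rw [hD, Set.mem_ofPred_eq, not_not] at hdD
        refine quantile_mono (fun x hx => ?_)
          (bddBelow_of_lt (monotone_cdf Q) (exists_cdf_lt Q (not_le.1 h0)))
          (exists_le_empCDF _ hp1.le)
        linarith [(abs_le.1 (hdD x)).2]
  have hlb : extPower PΩ Q S T P n (p + η)
      ≤ (drawLaw PΩ P n m J).real D + testPower PΩ F₀ S T P n m J α := by
    by_cases h1 : 1 ≤ p + η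
    · rw [extPower, if_neg (by linarith), if_pos h1]
      exact add_nonneg measureReal_nonneg measureReal_nonneg
    · rw [extPower, if_neg (by linarith), if_neg h1, sampleLaw_real_eq P n m J (hms _)]
      refine (measureReal_mono (fun d hd => ?_)).trans (measureReal_union_le _ _)
      by_cases hdD : d ∈ D
      · exact Or.inl hdD
      · refine Or.inr (lt_of_le_of_lt ?_
          (show quantile (cdf Q) (p + η) < S (T n d.1) from hd))
        rw [hD, Set.mem_ofPred_eq, not_not] at hdD
        refine quantile_mono (fun x hx => ?_)
          (bddBelow_of_lt (monotone_empCDF _) (exists_empCDF_lt _ hp0))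
          (exists_le_cdf Q (not_le.1 h1))
        linarith [(abs_le.1 (hdD x)).1]
  rw [hor, abs_le]
  constructor <;> linarith

/-- The difference in power to the oracle test vanishes in mean over the levels. -/
theorem tendsto_lintegral_power_sub (hJ : 0 < J)
    (hmn : Tendsto (fun n => n / m n) atTop atTop) (hT : ∀ n, Measurable (T n)) (hS : Measurable S)
    (hunif : ∀ η > 0, ∀ᶠ x : Σ n, Draw 𝒳 𝒲 n (m n) J in whp fun n => drawLaw PΩ (P n) n (m n) J,
      ∀ t, |rankSubCDF F₀ S T x.2 t - cdf Q t| ≤ η) :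
    Tendsto (fun n => ∫⁻ α in Set.Ioo (0 : ℝ) 1, ENNReal.ofReal
      |testPower PΩ F₀ S T (P n) n (m n) J α - oraclePower PΩ Q S T (P n) n α|) atTop (𝓝 0) := by
  rw [ENNReal.tendsto_nhds_zero]
  intro ε hε
  obtain ⟨r, hr, hrε⟩ := ENNReal.lt_iff_exists_nnreal_btwn.1 hε
  have hr' : (0 : ℝ) < r := by exact_mod_cast hr
  -- With `η = r / 4` the shifted increments integrate to at most `r / 2`; the other `r / 2` is for
  -- the exceptional event.
  have h1 := hunif (r / 4) (by positivity)
  rw [eventually_whp] at h1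
  have h2 := (ENNReal.tendsto_nhds_zero.1 h1) (ENNReal.ofReal (r / 2)) (by simpa using hr')
  filter_upwards [h2, hmn.eventually_gt_atTop 0] with n hn hnm
  set D : Set (Draw 𝒳 𝒲 n (m n) J) := {d | ¬ ∀ t, |rankSubCDF F₀ S T d t - cdf Q t| ≤ r / 4}
  set k : ℝ → ℝ := fun a => extPower PΩ Q S T (P n) n (1 - a) with hk
  have hkm : Monotone k := fun a b hab => antitone_extPower (P n) n (by linarith)
  have hDr : (drawLaw PΩ (P n) n (m n) J).real D ≤ r / 2 :=
    ENNReal.toReal_le_of_le_ofReal (by positivity) hn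
  calc _ ≤ ∫⁻ α in Set.Ioo (0 : ℝ) 1, (ENNReal.ofReal (r / 2)
          + ENNReal.ofReal (k (α + r / 4) - k (α - r / 4))) := by
        refine setLIntegral_mono' measurableSet_Ioo fun α hα => ?_
        rw [← ENNReal.ofReal_add (by positivity) (sub_nonneg.2 (hkm (by linarith)))]
        refine ENNReal.ofReal_le_ofReal
          ((abs_testPower_sub_oraclePower_le (Q := Q) (F₀ := F₀) hT hS (P n) hJ hnm
            (show 0 ≤ (r : ℝ) / 4 by positivity) hα).trans ?_)
        refine add_le_add hDr (le_of_eq ?_)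
        simp only [hk]
        congr 2 <;> ring
    _ = ENNReal.ofReal (r / 2)
          + ∫⁻ α in Set.Ioo (0 : ℝ) 1, ENNReal.ofReal (k (α + r / 4) - k (α - r / 4)) := by
        rw [lintegral_add_left measurable_const]
        simp
    _ ≤ ENNReal.ofReal (r / 2) + ENNReal.ofReal (2 * (r / 4)) := by
        gcongr
        exact lintegral_monotone_shift_sub_le hkm (fun x => extPower_mem_Icc (P n) n _)
          (by positivity)
    _ = r := by
        rw [← ENNReal.ofReal_add (by positivity) (by positivity)]
        rw [show (r : ℝ) / 2 + 2 * (r / 4) = r by ring, ENNReal.ofReal_coe_nnreal]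
    _ ≤ ε := hrε.le

/-- At a level at which the critical value converges to a point that the limit law of the
statistic does not charge, the difference in power to the oracle test vanishes. -/
theorem tendsto_power_sub_of_tendstoInDistribution (hT : ∀ n, Measurable (T n))
    (hS : Measurable S) {Q' : Measure ℝ} [IsProbabilityMeasure Q']
    (hQ' : TendstoInDistribution (fun (n : ℕ) z => S (T n z)) atTop id
      (fun n => sampleLaw PΩ (P n) n) Q') {α : ℝ}
    (hcrit : ∀ ε > 0, Tendsto (fun n => drawLaw PΩ (P n) n (m n) J
      {d | ε ≤ |critValue F₀ S T α d - quantile (cdf Q) (1 - α)|}) atTop (𝓝 0))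
    (hatom : Q' {quantile (cdf Q) (1 - α)} = 0) :
    Tendsto (fun n => testPower PΩ F₀ S T (P n) n (m n) J α - oraclePower PΩ Q S T (P n) n α)
      atTop (𝓝 0) := by
  set q := quantile (cdf Q) (1 - α) with hq
  rw [Metric.tendsto_nhds]
  intro ε hε
  have hε2 : (0 : ℝ≥0∞) < ENNReal.ofReal (ε / 2) := by simpa using hε
  -- Since `q` is not an atom, some closed interval around it has `Q'`-mass below `ε / 2`; the
  -- portmanteau inequality carries this over to `S_n`.
  have h1 := tendsto_measure_Icc_nhdsWithin_right' Q' q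
  rw [hatom] at h1
  obtain ⟨ρ, hρ1, hρ⟩ := ((h1.eventually (gt_mem_nhds hε2)).and self_mem_nhdsWithin).exists
  have hρ : 0 < ρ := hρ
  have h2 := ProbabilityMeasure.limsup_measure_closed_le_of_tendsto hQ'.tendsto
    (isClosed_Icc (a := q - ρ) (b := q + ρ))
  simp only [ProbabilityMeasure.coe_mk, Measure.map_id] at h2
  have h3 := eventually_lt_of_limsup_lt (h2.trans_lt hρ1)
  have h4 := (hcrit ρ hρ).eventually (gt_mem_nhds hε2)
  filter_upwards [h3, h4] with n hn3 hn4
  have hmeas : Measurable fun z => S (T n z) := hS.comp (hT n)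
  rw [Measure.map_apply hmeas measurableSet_Icc] at hn3
  set A : Set (Draw 𝒳 𝒲 n (m n) J) := {d | ρ ≤ |critValue F₀ S T α d - q|}
  set B : Set ((Fin n → 𝒳) × 𝒲) := (fun z => S (T n z)) ⁻¹' Set.Icc (q - ρ) (q + ρ)
  have hA : (drawLaw PΩ (P n) n (m n) J).real A < ε / 2 :=
    (ENNReal.lt_ofReal_iff_toReal_lt (measure_ne_top _ _)).1 hn4
  have hB : (drawLaw PΩ (P n) n (m n) J).real {d | d.1 ∈ B} < ε / 2 := by
    rw [← sampleLaw_real_eq (P n) n (m n) J (hmeas measurableSet_Icc)]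
    exact (ENNReal.lt_ofReal_iff_toReal_lt (measure_ne_top _ _)).1 hn3
  have hor : oraclePower PΩ Q S T (P n) n α
      = (drawLaw PΩ (P n) n (m n) J).real {d | d.1 ∈ {z | q < S (T n z)}} :=
    sampleLaw_real_eq (P n) n (m n) J (measurableSet_lt measurable_const hmeas)
  -- The tests can disagree only if the critical value is off by at least `ρ` or `S_n` is within `ρ`
  -- of `q`.
  have hclose : ∀ d, d ∉ A ∪ {d : Draw 𝒳 𝒲 n (m n) J | d.1 ∈ B} →
      (critValue F₀ S T α d < S (T n d.1) ↔ q < S (T n d.1)) := by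
    intro d hd
    rw [Set.mem_union, not_or] at hd
    have hd1 : |critValue F₀ S T α d - q| < ρ := not_le.1 hd.1
    have hd2 : ¬ (q - ρ ≤ S (T n d.1) ∧ S (T n d.1) ≤ q + ρ) := hd.2
    rw [abs_lt] at hd1
    rw [not_and_or, not_le, not_le] at hd2
    constructor <;> intro h <;> rcases hd2 with h' | h' <;> linarith
  have hdiff := abs_measureReal_sub_le (drawLaw PΩ (P n) n (m n) J)
    (A := {d | critValue F₀ S T α d < S (T n d.1)}) (B := {d | d.1 ∈ {z | q < S (T n z)}})
    (D := A ∪ {d : Draw 𝒳 𝒲 n (m n) J | d.1 ∈ B})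
    (fun d hd => or_iff_not_imp_right.2 fun hdD => (hclose d hdD).1 hd)
    (fun d hd => or_iff_not_imp_right.2 fun hdD => (hclose d hdD).2 hd)
  rw [Real.dist_eq, sub_zero, hor]
  refine hdiff.trans_lt ((measureReal_union_le _ _).trans_lt ?_)
  linarith

end Power

/-- At almost every level, the quantile function is continuous and avoids the atoms of a given
law. -/
theorem ae_continuousAt_quantile_and_notAtom (Q Q' : Measure ℝ) [IsProbabilityMeasure Q]
    [NullSingletonClass Q] [IsProbabilityMeasure Q'] :
    ∀ᵐ α ∂(volume.restrict (Set.Ioo (0 : ℝ) 1)), α ∈ Set.Ioo (0 : ℝ) 1 ∧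
      ContinuousAt (quantile (cdf Q)) (1 - α) ∧ Q' {quantile (cdf Q) (1 - α)} = 0 := by
  rw [ae_restrict_iff' measurableSet_Ioo]
  set A := {p | p ∈ Set.Ioo (0 : ℝ) 1 ∧ ¬ ContinuousWithinAt (quantile (cdf Q)) (Set.Ioo 0 1) p}
  set B := {p | p ∈ Set.Ioo (0 : ℝ) 1 ∧ Q' {quantile (cdf Q) p} ≠ 0}
  have hA : A.Countable := (monotoneOn_quantile_cdf Q).countable_not_continuousWithinAt
  -- `Q` has no atoms, so its quantile function is strictly increasing on `(0, 1)` and hits each of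
  -- the countably many atoms of `Q'` at most once.
  have hB : B.Countable := by
    have hc : {x : ℝ | 0 < Q' {x}}.Countable :=
      Measure.countable_meas_pos_of_disjoint_iUnion (fun x => measurableSet_singleton x)
        fun x y hxy => Set.disjoint_singleton.2 hxy
    refine Set.MapsTo.countable_of_injOn (f := quantile (cdf Q)) (fun p hp => ?_)
      ((strictMonoOn_quantile_cdf Q).injOn.mono fun p hp => hp.1) hc
    exact pos_iff_ne_zero.2 hp.2
  have hnull : volume ((fun α : ℝ => 1 - α) ⁻¹' (A ∪ B)) = 0 :=
    ((hA.union hB).preimage (sub_right_injective)).measure_zero _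
  refine (measure_eq_zero_iff_ae_notMem.1 hnull).mono fun α hα hα01 => ?_
  have hp : 1 - α ∈ Set.Ioo (0 : ℝ) 1 := ⟨by linarith [hα01.2], by linarith [hα01.1]⟩
  rw [Set.mem_preimage, Set.mem_union, not_or] at hα
  refine ⟨hα01, ?_, ?_⟩
  · by_contra h
    exact hα.1 ⟨hp, fun h' => h (h'.continuousAt (isOpen_Ioo.mem_nhds hp))⟩
  · by_contra h
    exact hα.2 ⟨hp, h⟩

end RankSub

/-! ### Proof of the theorem along local alternatives -/

theorem theorem3
    {𝒳 𝒲 : Type*} [TopologicalSpace 𝒳] [MeasurableSpace 𝒳] [OpensMeasurableSpace 𝒳]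
    [MeasurableSpace 𝒲] (PΩ : Measure 𝒲) [IsProbabilityMeasure PΩ]
    -- number of single-split statistics, number of permutations, subsample sizes
    (L : ℕ) [NeZero L] (J : ℕ) (hJ : 0 < J)
    (m : ℕ → ℕ) (hm : Tendsto m atTop atTop)
    (hmn : Tendsto (fun n : ℕ => (m n : ℝ) / (n : ℝ)) atTop (𝓝 0))
    -- the model and the null hypothesis
    (𝓜 𝓜₀ : Set (ProbabilityMeasure 𝒳)) (h𝓜 : 𝓜₀ ⊆ 𝓜)
    -- the single-split statistics, exchangeable under the null and the alternative
    (T : (n : ℕ) → (Fin n → 𝒳) × 𝒲 → Fin L → ℝ) (hT : ∀ n, Measurable (T n))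
    (hexch : ∀ P ∈ 𝓜, RankSub.IsExchangeable PΩ T P)
    -- asymptotically pivotal null, uniform or standard normal
    (F₀ : ProbabilityMeasure ℝ)
    (hF₀ : (F₀ : Measure ℝ) = volume.restrict (Set.Icc 0 1) ∨ (F₀ : Measure ℝ) = gaussianReal 0 1)
    (hpivot : ∀ P ∈ 𝓜₀, TendstoInDistribution (fun (n : ℕ) z => T n z 0) atTop id
      (RankSub.sampleLaw PΩ P) (F₀ : Measure ℝ))
    -- Lipschitz aggregation (for the maximum norm)
    (S : (Fin L → ℝ) → ℝ) (hS : LipschitzWith 1 S)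
    -- stability of the aggregated statistic under the null
    (G : ProbabilityMeasure 𝒳 → ProbabilityMeasure ℝ)
    (hG : ∀ P ∈ 𝓜₀, TendstoInDistribution (fun (n : ℕ) z => S (T n z)) atTop id
      (RankSub.sampleLaw PΩ P) (G P : Measure ℝ))
    (hdens : ∀ P ∈ 𝓜₀, RankSub.HasBoundedDensity (G P))
    -- locally uniform convergence of the copula at `P₀`
    (P₀ : ProbabilityMeasure 𝒳) (hP₀ : P₀ ∈ 𝓜₀)
    (C : ProbabilityMeasure (Fin L → ℝ))
    (hcopula : ∀ P : ℕ → ProbabilityMeasure 𝒳, (∀ n, P n ∈ 𝓜) → Tendsto P atTop (𝓝 P₀) →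
      TendstoInDistribution (fun n => RankSub.copulaVec PΩ T (P n) n) atTop id
        (fun n => RankSub.sampleLaw PΩ (P n) n) (C : Measure (Fin L → ℝ))) :
    ∀ P : ℕ → ProbabilityMeasure 𝒳, (∀ n, P n ∈ 𝓜) → Tendsto P atTop (𝓝 P₀) →
      -- the critical value converges in probability to that of the oracle test
      (∀ α ∈ Set.Ioo (0 : ℝ) 1,
        ContinuousAt (RankSub.quantile (cdf (G P₀ : Measure ℝ))) (1 - α) →
        ∀ ε > 0, Tendsto (fun n => RankSub.drawLaw PΩ (P n) n (m n) J
            {d | ε ≤ |RankSub.critValue (cdf (F₀ : Measure ℝ)) S T α d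
              - RankSub.quantile (cdf (G P₀ : Measure ℝ)) (1 - α)|}) atTop (𝓝 0)) ∧
      -- the power difference to the oracle test vanishes in mean over the levels
      Tendsto (fun n => ∫⁻ α in Set.Ioo (0 : ℝ) 1, ENNReal.ofReal
          |RankSub.testPower PΩ (cdf (F₀ : Measure ℝ)) S T (P n) n (m n) J α
            - RankSub.oraclePower PΩ (G P₀ : Measure ℝ) S T (P n) n α|) atTop (𝓝 0) ∧
      -- and at almost every level, if `S_n` has a limit law along the local alternatives
      (∀ Q : ProbabilityMeasure ℝ,
        TendstoInDistribution (fun (n : ℕ) z => S (T n z)) atTop id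
          (fun n => RankSub.sampleLaw PΩ (P n) n) (Q : Measure ℝ) →
        ∀ᵐ α ∂(volume.restrict (Set.Ioo (0 : ℝ) 1)),
          Tendsto (fun n =>
            RankSub.testPower PΩ (cdf (F₀ : Measure ℝ)) S T (P n) n (m n) J α
              - RankSub.oraclePower PΩ (G P₀ : Measure ℝ) S T (P n) n α) atTop (𝓝 0)) := by
  have hG₀ : NullSingletonClass (G P₀ : Measure ℝ) := by
    obtain ⟨g, -, -, hg⟩ := hdens P₀ hP₀
    rw [hg]
    infer_instance
  have hreg := RankSub.isRegular_cdf (F₀ : Measure ℝ) hF₀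
  have hF₀na : NullSingletonClass (F₀ : Measure ℝ) := by
    rcases hF₀ with h | h
    · rw [h]; infer_instance
    · rw [h]; exact nullSingletonClass_gaussianReal one_ne_zero
  have hex₀ := hexch P₀ (h𝓜 hP₀)
  -- The constant sequence `P₀` determines the marginals of `C`, which is the same limit for all
  -- local sequences.
  have hC₀ := hcopula (fun _ => P₀) (fun _ => h𝓜 hP₀) tendsto_const_nhds
  have hmarg₀ : ∀ l, ∀ v ∈ Set.Ioo (0 : ℝ) 1, (C : Measure (Fin L → ℝ)).map (fun u => u l) {v} = 0 ∧
      ((C : Measure (Fin L → ℝ)).map (fun u => u l)).real (Set.Iic v) = v := fun l => by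
    have : IsProbabilityMeasure ((C : Measure (Fin L → ℝ)).map (fun u => u l)) :=
      Measure.isProbabilityMeasure_map (measurable_pi_apply l).aemeasurable
    exact RankSub.uniform_of_tendstoInDistribution
      (RankSub.tendstoInDistribution_coordinate hC₀ l) fun v hv =>
        RankSub.tendsto_real_copulaVec_le hT hex₀ (hpivot P₀ hP₀) l hv
  have hdiv := RankSub.tendsto_div_atTop hm hmn
  intro P hP hPlim
  have hC : TendstoInDistribution (fun n => RankSub.copulaVec PΩ T (P n) (m n)) atTop id
      (fun n => RankSub.sampleLaw PΩ (P n) (m n)) (C : Measure (Fin L → ℝ)) :=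
    { forall_aemeasurable := fun n => (RankSub.measurable_copulaVec hT (P n) (m n)).aemeasurable
      aemeasurable_limit := aemeasurable_id
      -- The law `P n` is paired with the sample size `m n` rather than `n`, so the hypothesis is
      -- applied to a re-indexed sequence.
      tendsto := RankSub.tendsto_of_forall_seq (β := ProbabilityMeasure (Fin L → ℝ)) (s := 𝓜) (h𝓜 hP₀)
        (f := fun P n => (⟨(RankSub.sampleLaw PΩ P n).map (RankSub.copulaVec PΩ T P n),
          Measure.isProbabilityMeasure_map
            (RankSub.measurable_copulaVec hT P n).aemeasurable⟩ :
              ProbabilityMeasure (Fin L → ℝ)))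
        (fun a ha ha' => (hcopula a ha ha').tendsto) hm hP hPlim }
  -- Under `P n` the uniform marginals come from those of `C`, as the pivotal limit is only
  -- available under the null.
  have hmarg : ∀ l, ∀ v ∈ Set.Ioo (0 : ℝ) 1, Tendsto (fun n =>
      (RankSub.sampleLaw PΩ (P n) (m n)).real
        {z | RankSub.copulaVec PΩ T (P n) (m n) z l ≤ v}) atTop (𝓝 v) := fun l v hv => by
    have : IsProbabilityMeasure ((C : Measure (Fin L → ℝ)).map (fun u => u l)) :=
      Measure.isProbabilityMeasure_map (measurable_pi_apply l).aemeasurable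
    have h := RankSub.tendsto_real_le_of_tendstoInDistribution
      (RankSub.tendstoInDistribution_coordinate hC l) (hmarg₀ l v hv).1
    rwa [(hmarg₀ l v hv).2] at h
  have hunif := fun η (hη : 0 < η) => RankSub.eventually_abs_rankSubCDF_sub_le (PΩ := PΩ) (J := J)
    (m := m) (P := P) (T := T) (F₀ := cdf (F₀ : Measure ℝ)) (S := S) (Q := (G P₀ : Measure ℝ))
    (fun t ε hε => RankSub.tendsto_rowMean_rankTransform hJ hdiv hT hmarg hC hreg
      hS.uniformContinuous (RankSub.uniformContinuous_ramp t ε) (RankSub.ramp_mem_Icc t ε)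
      fun δ hδ hδ' => RankSub.abs_integral_sub_integral_truncAgg_le hT hex₀ hreg (hpivot P₀ hP₀)
        hS.uniformContinuous (hG P₀ hP₀) hC₀ (RankSub.uniformContinuous_ramp t ε)
        (RankSub.ramp_mem_Icc t ε) hδ hδ') hη
  have hcrit := fun α (hα : α ∈ Set.Ioo (0 : ℝ) 1) hc ε (hε : ε > 0) =>
    RankSub.tendsto_critValue hunif (α := α) hα hc hε
  refine ⟨hcrit, RankSub.tendsto_lintegral_power_sub hJ hdiv hT hS.continuous.measurable hunif,
    fun Q hQ => ?_⟩
  filter_upwards [RankSub.ae_continuousAt_quantile_and_notAtom (G P₀ : Measure ℝ)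
    (Q : Measure ℝ)] with α ⟨hα, hc, hatom⟩
  exact RankSub.tendsto_power_sub_of_tendstoInDistribution hT hS.continuous.measurable hQ
    (fun ε hε => hcrit α hα hc ε hε) hatom
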